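/- Let $N\ge 2$, let $x_0<x_1<\dots<x_N$ and $y_0,\dots,y_N$ be real numbers, and put $I=[x_0,x_N]$. For $1\le i\le N$ let $L_i$ be the affine map with $L_i(x_0)=x_{i-1}$, $L_i(x_N)=x_i$, let $S_i,q_i$ be continuous real functions on $I$ with $|S_i|<1$ on $I$, $S_i(x_0)y_0+q_i(x_0)=y_{i-1}$ and $S_i(x_N)y_N+q_i(x_N)=y_i$, and put $W_i(x,y)=(L_i(x),\,S_i(x)y+q_i(x))$. Let $f$ be the corresponding generalized affine fractal interpolation function, i.e. the continuous function on $I$ whose graph $\Gamma f=\{(x,f(x)):x\in I\}$ satisfies $\Gamma f=\bigcup_{i=1}^N W_i(\Gamma f)$. Assume for every $i$: (A1) $x_i-x_{i-1}=(x_N-x_0)/N$; (A2) $S_i$ is Lipschitz on $I$ and $|S_i|<1$ on $I$; (A3) $q_i$ is of bounded variation on $I$. Put $\gamma_*=\min_{x\in I}\sum_{i=1}^N|S_i(x)|$. For $k\ge1$ let $I^k_1,\dots,I^k_{N^k}$ be the division of $I$, from left to right, into $N^k$ closed intervals of equal length, and let $\overline s^{\,k}_{i,j}=\max_{I^k_j}|S_i|$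 and $\underline s^{\,k}_{i,j}=\min_{I^k_j}|S_i|$. Let $\overline M_k$ be the $N^k\times N^k$ matrix such that, for $1\le i\le N$, $1\le\ell\le N^{k-1}$ and $1\le j\le N^k$, the entry in row $(i-1)N^{k-1}+\ell$ and column $j$ is $\overline s^{\,k}_{i,j}$ if $(\ell-1)N<j\le\ell N$, and $0$ otherwise; let $\underline M_k$ be the same matrix with $\underline s^{\,k}_{i,j}$ in place of $\overline s^{\,k}_{i,j}$. Let $\rho(A)$ denote the spectral radius of a matrix $A$, $\mathrm{Var}(f,I)\in[0,\infty]$ the total variation of $f$ on $I$, and $\overline{\dim}_B,\underline{\dim}_B,\dim_B$ the upper, the lower and the box dimension. Then the limits $\rho^*=\lim_{k\to\infty}\rho(\overline M_k)$ and $\rho_*=\lim_{k\to\infty}\rho(\underline M_k)$ exist in $[0,\infty)$, and the following hold. (1) If no $S_i$ vanishes identically on any nondegenerate subinterval of $I$, then $\overline{\dim}_B\Gamma f\le\max\{1,\,1+\log\rho^*/\log N\}$ (the right-hand side being $1$ if $\rho^*=0$). (2) If $\gamma_*\ge1$, each $S_i$ has only finitely many zeros on $I$, and $\mathrm{Var}(f,I)=\infty$,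 then $\underline{\dim}_B\Gamma f\ge1+\log\rho_*/\log N$. (3) Suppose that $\rho^*=\rho_*=:\rho_{\mathbf S}$ and each $S_i$ has only finitely many zeros on $I$. If $\mathrm{Var}(f,I)=\infty$ and $\rho_{\mathbf S}>1$, then $\dim_B\Gamma f$ exists and equals $1+\log\rho_{\mathbf S}/\log N$; otherwise $\dim_B\Gamma f$ exists and equals $1$. -/

import Mathlib

open Filter Topology

/-! ### Box dimension of plane sets -/

/-- The `ε`-coordinate square `[k₁ε, (k₁+1)ε] × [k₂ε, (k₂+1)ε]`. -/
def coordSquare (ε : ℝ) (k : ℤ × ℤ) : Set (ℝ × ℝ) :=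
  Set.Icc (k.1 * ε) ((k.1 + 1) * ε) ×ˢ Set.Icc (k.2 * ε) ((k.2 + 1) * ε)

/-- The number of `ε`-coordinate squares that meet the bounded set `E`. -/
noncomputable def boxCount (E : Set (ℝ × ℝ)) (ε : ℝ) : ℕ :=
  {k : ℤ × ℤ | (coordSquare ε k ∩ E).Nonempty}.ncard

/-- Upper box dimension of a bounded set, with the upper limit taken in the extended reals. -/
noncomputable def upperBoxDim (E : Set (ℝ × ℝ)) : EReal :=
  limsup (fun ε : ℝ => ((Real.log (boxCount E ε) / Real.log (1 / ε) : ℝ) : EReal)) (𝓝[>] 0)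

/-- Lower box dimension of a bounded set, with the lower limit taken in the extended reals. -/
noncomputable def lowerBoxDim (E : Set (ℝ × ℝ)) : EReal :=
  liminf (fun ε : ℝ => ((Real.log (boxCount E ε) / Real.log (1 / ε) : ℝ) : EReal)) (𝓝[>] 0)

/-- The box dimension of `E` exists and equals `d`. -/
def HasBoxDim (E : Set (ℝ × ℝ)) (d : ℝ) : Prop :=
  lowerBoxDim E = (d : EReal) ∧ upperBoxDim E = (d : EReal)

/-! ### Spectral radius of a real square matrix -/

/-- The largest modulus of a complex eigenvalue of the real square matrix `A`. -/
noncomputable def matrixSpectralRadius {n : ℕ} (A : Matrix (Fin n) (Fin n) ℝ) : ℝ :=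
  (spectralRadius ℂ (A.map Complex.ofReal)).toReal

/-! ### Generalized affine fractal interpolation functions -/

/-- The data of a generalized affine iterated function system
`W_i(x, y) = (a_i x + b_i, S_i(x) y + q_i(x))`, `1 ≤ i ≤ N`, interpolating the points
`(x_0, y_0), …, (x_N, y_N)`.  The index `i : Fin N` stands for the number `i + 1`, so that
`x i.castSucc` and `x i.succ` are the end points of the `i`-th interval of the partition.
Only the values of `S i` and `q i` on `[x_0, x_N]` matter. -/
structure AffineIFS (N : ℕ) where
  x : Fin (N + 1) → ℝ
  y : Fin (N + 1) → ℝ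
  S : Fin N → ℝ → ℝ
  q : Fin N → ℝ → ℝ
  two_le : 2 ≤ N
  strictMono_x : StrictMono x
  continuousOn_S : ∀ i, ContinuousOn (S i) (Set.Icc (x 0) (x (Fin.last N)))
  continuousOn_q : ∀ i, ContinuousOn (q i) (Set.Icc (x 0) (x (Fin.last N)))
  abs_S_lt_one : ∀ i, ∀ t ∈ Set.Icc (x 0) (x (Fin.last N)), |S i t| < 1
  left_end : ∀ i, S i (x 0) * y 0 + q i (x 0) = y i.castSucc
  right_end : ∀ i, S i (x (Fin.last N)) * y (Fin.last N) + q i (x (Fin.last N)) = y i.succ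

namespace AffineIFS

variable {N : ℕ} (W : AffineIFS N)

/-- The interval `I = [x_0, x_N]`. -/
def I : Set ℝ := Set.Icc (W.x 0) (W.x (Fin.last N))

/-- The affine map with `x_0 ↦ x_{i-1}` and `x_N ↦ x_i`. -/
noncomputable def L (i : Fin N) (t : ℝ) : ℝ :=
  (W.x i.succ - W.x i.castSucc) / (W.x (Fin.last N) - W.x 0) * (t - W.x 0) + W.x i.castSucc

/-- The map `W_i(x, y) = (L_i(x), S_i(x) y + q_i(x))`. -/
noncomputable def map (i : Fin N) (p : ℝ × ℝ) : ℝ × ℝ :=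
  (W.L i p.1, W.S i p.1 * p.2 + W.q i p.1)

/-- The graph of `f` over `I`. -/
def graph (f : ℝ → ℝ) : Set (ℝ × ℝ) := (fun t => (t, f t)) '' W.I

/-- `f` (restricted to `I`) is the fractal interpolation function of the system: it is
continuous on `I` and its graph is invariant, `Γf = ⋃ i, W_i(Γf)`. -/
def IsFIF (f : ℝ → ℝ) : Prop :=
  ContinuousOn f W.I ∧ W.graph f = ⋃ i, W.map i '' W.graph f

/-- Condition (A1): the nodes are equally spaced. -/
def A1 : Prop :=
  ∀ i : Fin N, W.x i.succ - W.x i.castSucc = (W.x (Fin.last N) - W.x 0) / N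

/-- Condition (A2): each `S_i` is Lipschitz on `I`, with `|S_i| < 1` there. -/
def A2 : Prop :=
  ∀ i : Fin N, (∃ K, LipschitzOnWith K (W.S i) W.I) ∧ ∀ t ∈ W.I, |W.S i t| < 1

/-- Condition (A3): each `q_i` is of bounded variation on `I`. -/
def A3 : Prop := ∀ i : Fin N, BoundedVariationOn (W.q i) W.I

/-- The sum function `γ = ∑ |S_i|`. -/
noncomputable def gamma (t : ℝ) : ℝ := ∑ i, |W.S i t|

/-- The minimum `γ_*` of `γ` on `I`. -/
noncomputable def gammaLow : ℝ := sInf (W.gamma '' W.I)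

/-- The `j`-th interval of the subdivision of `I` into `N ^ k` equal closed intervals
(`j` is counted from `0`). -/
def subI (k : ℕ) (j : Fin (N ^ k)) : Set ℝ :=
  Set.Icc (W.x 0 + (j : ℝ) / (N : ℝ) ^ k * (W.x (Fin.last N) - W.x 0))
    (W.x 0 + ((j : ℝ) + 1) / (N : ℝ) ^ k * (W.x (Fin.last N) - W.x 0))

/-- The maximum of `|S_i|` on the `j`-th interval of level `k`. -/
noncomputable def sUp (k : ℕ) (i : Fin N) (j : Fin (N ^ k)) : ℝ :=
  sSup ((fun t => |W.S i t|) '' W.subI k j)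

/-- The minimum of `|S_i|` on the `j`-th interval of level `k`. -/
noncomputable def sLow (k : ℕ) (i : Fin N) (j : Fin (N ^ k)) : ℝ :=
  sInf ((fun t => |W.S i t|) '' W.subI k j)

end AffineIFS

/-- The `N ^ (k+1) × N ^ (k+1)` matrix built from numbers `s i j`: with all indices counted from
`0`, row `i * N ^ k + ℓ` (`i < N`, `ℓ < N ^ k`) has the entry `s i j` in the columns
`ℓ * N ≤ j < (ℓ + 1) * N`, and `0` elsewhere. -/
def scalingMatrix (N k : ℕ) (s : Fin N → Fin (N ^ (k + 1)) → ℝ) :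
    Matrix (Fin (N ^ (k + 1))) (Fin (N ^ (k + 1))) ℝ :=
  Matrix.of fun r j =>
    if r.val % N ^ k * N ≤ j.val ∧ j.val < (r.val % N ^ k + 1) * N then
      s ⟨r.val / N ^ k, Nat.div_lt_of_lt_mul (lt_of_lt_of_eq r.isLt (pow_succ N k))⟩ j
    else 0

namespace AffineIFS

variable {N : ℕ} (W : AffineIFS N)

/-- The upper vertical scaling matrix of level `k + 1`. -/
noncomputable def MUp (k : ℕ) : Matrix (Fin (N ^ (k + 1))) (Fin (N ^ (k + 1))) ℝ :=
  scalingMatrix N k (W.sUp (k + 1))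

/-- The lower vertical scaling matrix of level `k + 1`. -/
noncomputable def MLow (k : ℕ) : Matrix (Fin (N ^ (k + 1))) (Fin (N ^ (k + 1))) ℝ :=
  scalingMatrix N k (W.sLow (k + 1))

end AffineIFS

/-! Rescaled to `[0, 1]`, the interpolation function satisfies `F((i + t)/N) = S_i(t) F(t) +
q_i(t)`. On the `i`-th copy of a cell the oscillation of `F` is therefore about `|S_i|` times its
oscillation on the cell. The error is at most `sup |F| * osc S_i + osc q_i`, and since `S_i` and
`q_i` have bounded variation these errors, summed over all cells of one level, stay bounded
independently of the level.

Fix `k` and let `V_p(r)` be the sum of the oscillations over the cells of level `k + 1 + p` inside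
the `r`-th cell of level `k + 1`. Cell `r = i * N ^ k + ℓ` is the `i`-th copy of cell `ℓ` of level
`k`, whose children are `ℓ * N + d`; this is the pattern of the scaling matrices, so `MLow V_p - C ≤
V_(p+1) ≤ MUp V_p + C` (`oscVec_succ_le`, `le_oscVec_succ`). Since about `N ^ m + N ^ m * oscSum F
(N ^ m)` squares of side `N ^ (-m)` meet the graph (`boxCount_le`, `sum_max_le_boxCount`), the
growth rate `θ ≥ 1` of the total oscillation becomes the dimension `1 + log θ / log N`.

Upper bound: every `θ > 1` above the radius of `MUp` dominates the affine recursion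
(`sum_le_of_affine_recursion`). Lower bound: for `1 < θ` below the radius of `MLow` a nonnegative
vector with `θ u ≤ A u` exists without any irreducibility (`exists_superharmonic`), and a large
multiple of it propagates despite the loss `C` (`le_sum_of_affine_recursion`). To start, every
coordinate of `V_p` must become large, so `F` must have infinite variation on every cell. This
follows from infinite variation on `I` (`SelfAffine.eVariationOn_cell_eq_top`): points with infinite
variation in each neighbourhood are carried by each branch with `S_i ≠ 0` to points of the same
kind. If there were only finitely many, the coefficients of a high iterate would have a small
absolute sum at each of them, and the variation would be finite. So there are infinitely many, and
some avoid the finitely many zeros.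

The limits exist because matrices of consecutive levels are intertwined, up to an inequality, by the
matrix that sums over children, so the radii are monotone in the level. Letting `θ` tend to the
limits gives the theorem. -/

/-! ### Growth of powers of nonnegative matrices -/

section SpectralRadius

open Matrix

-- This is the maximal row sum norm. On nonnegative matrices it agrees with `entrySum` up to the
-- factor `n`, so Gelfand's formula turns into a statement about entry sums.
attribute [local instance] Matrix.linftyOpNormedRing Matrix.linftyOpNormedAlgebra

/-- The sum of all entries of a matrix. -/
def entrySum {m n : Type*} [Fintype m] [Fintype n] (A : Matrix m n ℝ) : ℝ := ∑ i, ∑ j, A i j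

lemma entrySum_mono {m n : Type*} [Fintype m] [Fintype n] {A B : Matrix m n ℝ}
    (h : ∀ i j, A i j ≤ B i j) : entrySum A ≤ entrySum B :=
  Finset.sum_le_sum fun i _ => Finset.sum_le_sum fun j _ => h i j

lemma mul_entry_mono {l m n : Type*} [Fintype m] {A B : Matrix l m ℝ} {C D : Matrix m n ℝ}
    (hA : ∀ i j, 0 ≤ A i j) (hD : ∀ i j, 0 ≤ D i j) (hAB : ∀ i j, A i j ≤ B i j)
    (hCD : ∀ i j, C i j ≤ D i j) (i : l) (j : n) : (A * C) i j ≤ (B * D) i j := by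
  simp only [Matrix.mul_apply]
  exact Finset.sum_le_sum fun x _ => by
    nlinarith [mul_le_mul_of_nonneg_left (hCD x j) (hA i x),
      mul_le_mul_of_nonneg_right (hAB i x) (hD x j)]

lemma mul_entry_nonneg {l m n : Type*} [Fintype m] {A : Matrix l m ℝ} {C : Matrix m n ℝ}
    (hA : ∀ i j, 0 ≤ A i j) (hC : ∀ i j, 0 ≤ C i j) (i : l) (j : n) : 0 ≤ (A * C) i j := by
  simp only [Matrix.mul_apply]
  exact Finset.sum_nonneg fun x _ => mul_nonneg (hA i x) (hC x j)

lemma pow_entry_nonneg {n : Type*} [Fintype n] [DecidableEq n] {A : Matrix n n ℝ}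
    (hA : ∀ i j, 0 ≤ A i j) (p : ℕ) : ∀ i j, 0 ≤ (A ^ p) i j := by
  induction p with
  | zero => intro i j; rw [pow_zero, Matrix.one_apply]; split_ifs <;> norm_num
  | succ p ih => rw [pow_succ]; exact mul_entry_nonneg ih hA

lemma entrySum_nonneg {m n : Type*} [Fintype m] [Fintype n] {A : Matrix m n ℝ}
    (h : ∀ i j, 0 ≤ A i j) : 0 ≤ entrySum A :=
  Finset.sum_nonneg fun i _ => Finset.sum_nonneg fun j _ => h i j

lemma mulVec_nonneg_of_nonneg {m n : Type*} [Fintype n] {A : Matrix m n ℝ} {v : n → ℝ}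
    (hA : ∀ i j, 0 ≤ A i j) (hv : ∀ j, 0 ≤ v j) (i : m) : 0 ≤ (A *ᵥ v) i :=
  Finset.sum_nonneg fun j _ => mul_nonneg (hA i j) (hv j)

lemma mulVec_mono_of_nonneg {m n : Type*} [Fintype n] {A : Matrix m n ℝ} {v w : n → ℝ}
    (hA : ∀ i j, 0 ≤ A i j) (hvw : ∀ j, v j ≤ w j) (i : m) : (A *ᵥ v) i ≤ (A *ᵥ w) i :=
  Finset.sum_le_sum fun j _ => mul_le_mul_of_nonneg_left (hvw j) (hA i j)

variable {n : ℕ}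

lemma norm_map_ofReal_le_entrySum {A : Matrix (Fin n) (Fin n) ℝ} (hA : ∀ i j, 0 ≤ A i j) :
    ‖A.map Complex.ofReal‖ ≤ entrySum A := by
  rw [Matrix.linfty_opNorm_def]
  rw [← NNReal.coe_mk (entrySum A) (entrySum_nonneg hA), NNReal.coe_le_coe]
  refine Finset.sup_le fun i _ => ?_
  rw [← NNReal.coe_le_coe]
  push_cast
  have : ∀ j, ‖A.map Complex.ofReal i j‖ = A i j := fun j => by
    simp [abs_of_nonneg (hA i j)]
  simp only [this]
  exact Finset.single_le_sum (f := fun i => ∑ j, A i j)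
    (fun i _ => Finset.sum_nonneg fun j _ => hA i j) (Finset.mem_univ i)

lemma entrySum_le_norm_map_ofReal {A : Matrix (Fin n) (Fin n) ℝ} (hA : ∀ i j, 0 ≤ A i j) :
    entrySum A ≤ n * ‖A.map Complex.ofReal‖ := by
  have : ∀ i, ∑ j, A i j ≤ ‖A.map Complex.ofReal‖ := by
    intro i
    rw [Matrix.linfty_opNorm_def]
    have h := Finset.le_sup (f := fun i => ∑ j, ‖A.map Complex.ofReal i j‖₊) (Finset.mem_univ i)
    rw [← NNReal.coe_le_coe] at h
    refine le_trans (le_of_eq ?_) h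
    push_cast
    exact Finset.sum_congr rfl fun j _ => by simp [abs_of_nonneg (hA i j)]
  calc entrySum A ≤ ∑ _i : Fin n, ‖A.map Complex.ofReal‖ := Finset.sum_le_sum fun i _ => this i
    _ = _ := by simp

lemma map_ofReal_pow (A : Matrix (Fin n) (Fin n) ℝ) (p : ℕ) :
    (A.map Complex.ofReal) ^ p = (A ^ p).map Complex.ofReal :=
  (Matrix.map_pow A Complex.ofRealHom p).symm

/-- Finiteness is needed since `toReal` would send `⊤` to `0`. -/
lemma spectralRadius_map_ne_top (A : Matrix (Fin n) (Fin n) ℝ) :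
    spectralRadius ℂ (A.map Complex.ofReal) ≠ ⊤ := by
  have h := spectrum.spectralRadius_le_pow_nnnorm_pow_one_div ℂ (A.map Complex.ofReal) 0
  refine ne_top_of_le_ne_top ?_ h
  simpa using ENNReal.mul_ne_top ENNReal.coe_ne_top ENNReal.coe_ne_top

lemma matrixSpectralRadius_nonneg (A : Matrix (Fin n) (Fin n) ℝ) : 0 ≤ matrixSpectralRadius A :=
  ENNReal.toReal_nonneg

lemma tendsto_norm_pow (A : Matrix (Fin n) (Fin n) ℝ) :
    Tendsto (fun p : ℕ => ‖(A ^ p).map Complex.ofReal‖ ^ (1 / p : ℝ)) atTop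
      (𝓝 (matrixSpectralRadius A)) := by
  have h := spectrum.pow_norm_pow_one_div_tendsto_nhds_spectralRadius (A.map Complex.ofReal)
  have h2 := (ENNReal.tendsto_toReal (spectralRadius_map_ne_top A)).comp h
  refine h2.congr fun p => ?_
  simp only [Function.comp]
  rw [ENNReal.toReal_ofReal (by positivity), map_ofReal_pow]

/-- Gelfand's formula handles all large `p`, with the factor `n` from the row sum norm; the finitely
many remaining powers are absorbed in `C`. -/
lemma exists_entrySum_pow_le {A : Matrix (Fin n) (Fin n) ℝ} (hA : ∀ i j, 0 ≤ A i j) {θ : ℝ}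
    (hθ : matrixSpectralRadius A < θ) : ∃ C, 0 ≤ C ∧ ∀ p, entrySum (A ^ p) ≤ C * θ ^ p := by
  have hθ0 : 0 < θ := (matrixSpectralRadius_nonneg A).trans_lt hθ
  have hev := (tendsto_norm_pow A).eventually (gt_mem_nhds hθ)
  obtain ⟨p₀, hp₀⟩ := eventually_atTop.1 hev
  have hs : ∀ p, 0 ≤ entrySum (A ^ p) := fun p => entrySum_nonneg (pow_entry_nonneg hA p)
  refine ⟨n + ∑ p ∈ Finset.range (p₀ + 1), entrySum (A ^ p) / θ ^ p, ?_, fun p => ?_⟩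
  · have : 0 ≤ ∑ p ∈ Finset.range (p₀ + 1), entrySum (A ^ p) / θ ^ p :=
      Finset.sum_nonneg fun p _ => div_nonneg (hs p) (by positivity)
    positivity
  rcases lt_or_ge p (p₀ + 1) with hp | hp
  · have h1 := Finset.single_le_sum (f := fun p => entrySum (A ^ p) / θ ^ p)
      (fun p _ => div_nonneg (hs p) (by positivity)) (Finset.mem_range.2 hp)
    rw [div_le_iff₀ (by positivity)] at h1
    refine h1.trans ?_
    gcongr
    have : (0:ℝ) ≤ n := by positivity
    linarith
  · have h1 := (hp₀ p (by omega)).le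
    have h2 : ‖(A ^ p).map Complex.ofReal‖ ≤ θ ^ p := by
      have := Real.rpow_le_rpow (by positivity) h1 (z := (p : ℝ)) (by positivity)
      rw [← Real.rpow_mul (norm_nonneg _), one_div_mul_cancel (by
        have : 0 < p := by omega
        positivity), Real.rpow_one, Real.rpow_natCast] at this
      exact this
    calc entrySum (A ^ p) ≤ n * ‖(A ^ p).map Complex.ofReal‖ :=
          entrySum_le_norm_map_ofReal (pow_entry_nonneg hA p)
      _ ≤ n * θ ^ p := by gcongr
      _ ≤ _ := by
        gcongr
        have : 0 ≤ ∑ p ∈ Finset.range (p₀ + 1), entrySum (A ^ p) / θ ^ p :=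
          Finset.sum_nonneg fun p _ => div_nonneg (hs p) (by positivity)
        linarith

lemma matrixSpectralRadius_le {A : Matrix (Fin n) (Fin n) ℝ} (hA : ∀ i j, 0 ≤ A i j) {θ C : ℝ}
    (hθ : 0 ≤ θ) (h : ∀ p, entrySum (A ^ p) ≤ C * θ ^ p) : matrixSpectralRadius A ≤ θ := by
  -- The sign of `C` is unknown; a positive constant has `p`-th roots tending to `1`.
  have hC : 0 < max C 1 := by positivity
  have hlim : Tendsto (fun p : ℕ => (max C 1) ^ (1 / p : ℝ) * θ) atTop (𝓝 θ) := by
    have h0 : Tendsto (fun p : ℕ => (1 / p : ℝ)) atTop (𝓝 0) :=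
      tendsto_one_div_atTop_nhds_zero_nat
    have := ((Real.continuous_const_rpow hC.ne').tendsto 0).comp h0
    simpa using this.mul_const θ
  refine le_of_tendsto_of_tendsto (tendsto_norm_pow A) hlim ?_
  filter_upwards [eventually_gt_atTop 0] with p hp
  have h1 : ‖(A ^ p).map Complex.ofReal‖ ≤ max C 1 * θ ^ p := by
    refine (norm_map_ofReal_le_entrySum (pow_entry_nonneg hA p)).trans ((h p).trans ?_)
    gcongr
    exact le_max_left _ _
  calc ‖(A ^ p).map Complex.ofReal‖ ^ (1 / p : ℝ) ≤ (max C 1 * θ ^ p) ^ (1 / p : ℝ) := by gcongr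
    _ = _ := by
      rw [Real.mul_rpow hC.le (by positivity), ← Real.rpow_natCast, ← Real.rpow_mul hθ,
        mul_one_div_cancel (by positivity), Real.rpow_one]

end SpectralRadius

/-! ### Comparison of spectral radii and approximate Perron vectors. -/

section Comparison

variable {m n : ℕ}

lemma matrixSpectralRadius_mono {A B : Matrix (Fin n) (Fin n) ℝ} (hA : ∀ i j, 0 ≤ A i j)
    (hAB : ∀ i j, A i j ≤ B i j) : matrixSpectralRadius A ≤ matrixSpectralRadius B := by
  have hB : ∀ i j, 0 ≤ B i j := fun i j => (hA i j).trans (hAB i j)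
  refine le_of_forall_gt_imp_ge_of_dense fun θ hθ => ?_
  obtain ⟨C, -, hC⟩ := exists_entrySum_pow_le hB hθ
  refine matrixSpectralRadius_le hA ((matrixSpectralRadius_nonneg B).trans hθ.le)
    fun p => (entrySum_mono ?_).trans (hC p)
  induction p with
  | zero => intro i j; rfl
  | succ p ih =>
    rw [pow_succ, pow_succ]
    exact mul_entry_mono (pow_entry_nonneg hA p) hB ih hAB

lemma entrySum_mul_of_row_sums {l m n : Type*} [Fintype l] [Fintype m] [Fintype n]
    (A : Matrix l m ℝ) (P : Matrix m n ℝ) (c : ℝ) (hP : ∀ i, ∑ j, P i j = c) :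
    entrySum (A * P) = c * entrySum A := by
  simp only [entrySum, Matrix.mul_apply, Finset.mul_sum]
  refine Finset.sum_congr rfl fun i _ => ?_
  rw [Finset.sum_comm]
  refine Finset.sum_congr rfl fun j _ => ?_
  rw [← Finset.mul_sum, hP, mul_comm]

lemma entrySum_mul_of_col_sums {l m n : Type*} [Fintype l] [Fintype m] [Fintype n]
    (P : Matrix l m ℝ) (A : Matrix m n ℝ) (hP : ∀ j, ∑ i, P i j = 1) :
    entrySum (P * A) = entrySum A := by
  simp only [entrySum, Matrix.mul_apply]
  rw [Finset.sum_comm, Finset.sum_comm (f := fun i j => A i j)]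
  refine Finset.sum_congr rfl fun j _ => ?_
  rw [Finset.sum_comm]
  refine Finset.sum_congr rfl fun i _ => ?_
  rw [← Finset.sum_mul, hP, one_mul]

/-- The inequality `P B ≤ A P` iterates to `P B ^ p ≤ A ^ p P`. In entry sums the constant row and
column sums of `P` contribute only a constant factor, so the powers of `B` grow no faster than those
of `A`. -/
lemma matrixSpectralRadius_le_of_intertwine {A : Matrix (Fin m) (Fin m) ℝ}
    {B : Matrix (Fin n) (Fin n) ℝ} (hA : ∀ i j, 0 ≤ A i j) (hB : ∀ i j, 0 ≤ B i j)
    (P : Matrix (Fin m) (Fin n) ℝ) (hP : ∀ i j, 0 ≤ P i j) (c : ℝ) (hrow : ∀ i, ∑ j, P i j = c)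
    (hcol : ∀ j, ∑ i, P i j = 1) (h : ∀ i j, (P * B) i j ≤ (A * P) i j) :
    matrixSpectralRadius B ≤ matrixSpectralRadius A := by
  refine le_of_forall_gt_imp_ge_of_dense fun θ hθ => ?_
  obtain ⟨C, -, hC⟩ := exists_entrySum_pow_le hA hθ
  have key : ∀ (p : ℕ) i j, (P * B ^ p : Matrix (Fin m) (Fin n) ℝ) i j ≤ (A ^ p * P : Matrix (Fin m) (Fin n) ℝ) i j := by
    intro p
    induction p with
    | zero => intro i j; simp
    | succ p ih =>
      intro i j
      calc (P * B ^ (p + 1)) i j = (P * B ^ p * B) i j := by rw [pow_succ, Matrix.mul_assoc]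
        _ ≤ (A ^ p * P * B) i j := mul_entry_mono
            (mul_entry_nonneg hP (pow_entry_nonneg hB p)) hB ih (fun _ _ => le_rfl) i j
        _ = (A ^ p * (P * B)) i j := by rw [Matrix.mul_assoc]
        _ ≤ (A ^ p * (A * P)) i j := mul_entry_mono (pow_entry_nonneg hA p)
            (mul_entry_nonneg hA hP) (fun _ _ => le_rfl) h i j
        _ = _ := by rw [pow_succ, Matrix.mul_assoc]
  have hc : ∀ _i : Fin m, 0 ≤ c := fun i => by
    rw [← hrow i]; exact Finset.sum_nonneg fun j _ => hP i j
  -- The row sums force `0 ≤ c` only when `m` is not zero; `max` covers the empty case.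
  refine matrixSpectralRadius_le (C := max c 0 * C) hB ((matrixSpectralRadius_nonneg A).trans hθ.le)
    fun p => ?_
  rw [← entrySum_mul_of_col_sums P _ hcol]
  refine (entrySum_mono (key p)).trans ?_
  rw [entrySum_mul_of_row_sums _ _ c hrow, mul_assoc]
  have h0 := entrySum_nonneg (pow_entry_nonneg hA p)
  calc c * entrySum (A ^ p) ≤ max c 0 * entrySum (A ^ p) := by
        gcongr; exact le_max_left _ _
    _ ≤ _ := by
      gcongr
      exact hC p

lemma le_matrixSpectralRadius_of_intertwine {A : Matrix (Fin m) (Fin m) ℝ}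
    {B : Matrix (Fin n) (Fin n) ℝ} (hA : ∀ i j, 0 ≤ A i j) (hB : ∀ i j, 0 ≤ B i j)
    (P : Matrix (Fin m) (Fin n) ℝ) (hP : ∀ i j, 0 ≤ P i j) (c : ℝ) (hc : 0 < c)
    (hrow : ∀ i, ∑ j, P i j = c)
    (hcol : ∀ j, ∑ i, P i j = 1) (h : ∀ i j, (A * P) i j ≤ (P * B) i j) :
    matrixSpectralRadius A ≤ matrixSpectralRadius B := by
  refine le_of_forall_gt_imp_ge_of_dense fun θ hθ => ?_
  obtain ⟨C, -, hC⟩ := exists_entrySum_pow_le hB hθ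
  have key : ∀ (p : ℕ) i j, (A ^ p * P : Matrix (Fin m) (Fin n) ℝ) i j ≤
      (P * B ^ p : Matrix (Fin m) (Fin n) ℝ) i j := by
    intro p
    induction p with
    | zero => intro i j; simp
    | succ p ih =>
      intro i j
      calc (A ^ (p + 1) * P) i j = (A ^ p * (A * P)) i j := by rw [pow_succ, Matrix.mul_assoc]
        _ ≤ (A ^ p * (P * B)) i j := mul_entry_mono (pow_entry_nonneg hA p)
            (mul_entry_nonneg hP hB) (fun _ _ => le_rfl) h i j
        _ = (A ^ p * P * B) i j := by rw [Matrix.mul_assoc]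
        _ ≤ (P * B ^ p * B) i j := mul_entry_mono
            (mul_entry_nonneg (pow_entry_nonneg hA p) hP) hB ih (fun _ _ => le_rfl) i j
        _ = _ := by rw [pow_succ, Matrix.mul_assoc]
  refine matrixSpectralRadius_le (C := C / c) hA ((matrixSpectralRadius_nonneg B).trans hθ.le)
    fun p => ?_
  have h1 := (entrySum_mono (key p)).trans
    ((entrySum_mul_of_col_sums P _ hcol).le.trans (hC p))
  rw [entrySum_mul_of_row_sums _ _ c hrow] at h1
  rw [div_mul_eq_mul_div, le_div_iff₀ hc, mul_comm]
  exact h1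

open Matrix in
/-- A nonnegative matrix has approximate nonnegative Perron vectors. -/
lemma exists_superharmonic {A : Matrix (Fin n) (Fin n) ℝ} (hA : ∀ i j, 0 ≤ A i j) {θ : ℝ}
    (hθ : 0 < θ) (h : θ < matrixSpectralRadius A) :
    ∃ u : Fin n → ℝ, (∀ i, 0 ≤ u i) ∧ u ≠ 0 ∧ ∀ i, θ * u i ≤ (A *ᵥ u) i := by
  have hunb : ∀ C : ℝ, ∃ p, C * θ ^ p < entrySum (A ^ p) := by
    intro C
    by_contra! hc
    exact absurd (matrixSpectralRadius_le hA hθ.le hc) (not_le.2 h)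
  let w : ℕ → Fin n → ℝ := fun p => (A ^ p) *ᵥ (fun _ => 1)
  have hw0 : ∀ p i, 0 ≤ w p i := fun p i =>
    mulVec_nonneg_of_nonneg (pow_entry_nonneg hA p) (fun _ => zero_le_one) i
  have hwA : ∀ p, A *ᵥ w p = w (p + 1) := fun p => by
    simp only [w, Matrix.mulVec_mulVec, pow_succ']
  have hws : ∀ p, ∑ i, w p i = entrySum (A ^ p) := fun p => by
    simp [w, entrySum, Matrix.mulVec, dotProduct]
  -- Partial sums of the Neumann series of `(θ - A)⁻¹` applied to the vector `1`. They satisfy `A U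
  -- ≥ θ U - 1`, and below the spectral radius their mass is unbounded.
  let U : ℕ → Fin n → ℝ := fun p => ∑ m ∈ Finset.range (p + 1), (θ ^ (m + 1))⁻¹ • w m
  have hU0 : ∀ p i, 0 ≤ U p i := fun p i => by
    simp only [U, Finset.sum_apply, Pi.smul_apply, smul_eq_mul]
    exact Finset.sum_nonneg fun m _ => mul_nonneg (by positivity) (hw0 m i)
  have hUs : ∀ p, U (p + 1) = (θ ^ (p + 1 + 1))⁻¹ • w (p + 1) + U p := fun p => by
    simp only [U]; rw [Finset.sum_range_succ, add_comm]
  have hUe : ∀ p i, (A *ᵥ U p) i = θ * U p i - 1 + (θ ^ (p + 1))⁻¹ * w (p + 1) i := by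
    intro p i
    induction p with
    | zero =>
      simp only [U, zero_add, Finset.range_one, Finset.sum_singleton, pow_one, Pi.smul_apply,
        smul_eq_mul, Matrix.mulVec_smul, hwA]
      simp only [w, pow_zero, Matrix.one_mulVec]
      field_simp
      ring
    | succ p ih =>
      rw [hUs, Matrix.mulVec_add, Matrix.mulVec_smul, hwA]
      simp only [Pi.add_apply, Pi.smul_apply, smul_eq_mul]
      rw [ih]
      field_simp
      ring
  have hUA : ∀ p i, θ * U p i - 1 ≤ (A *ᵥ U p) i := fun p i => by
    rw [hUe]
    have := mul_nonneg (by positivity : 0 ≤ (θ ^ (p + 1))⁻¹) (hw0 (p + 1) i)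
    linarith
  have hsum : ∀ C : ℝ, ∃ p, C < ∑ i, U p i := by
    intro C
    obtain ⟨p, hp⟩ := hunb (C * θ)
    refine ⟨p, ?_⟩
    have h1 : (θ ^ (p + 1))⁻¹ * ∑ i, w p i ≤ ∑ i, U p i := by
      rw [Finset.mul_sum]
      refine Finset.sum_le_sum fun i _ => ?_
      simp only [U, Finset.sum_apply, Pi.smul_apply, smul_eq_mul]
      exact Finset.single_le_sum (f := fun m => (θ ^ (m + 1))⁻¹ * w m i)
        (fun m _ => mul_nonneg (by positivity) (hw0 m i)) (by simp)
    refine lt_of_lt_of_le ?_ h1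
    rw [hws, inv_mul_eq_div, lt_div_iff₀ (by positivity)]
    calc C * θ ^ (p + 1) = C * θ * θ ^ p := by ring
      _ < _ := hp
  -- Dividing by the mass `σ` puts the vectors in a compact set and turns the defect `1` into `1 /
  -- σ`, which vanishes in the limit; total mass `1` keeps the limit nonzero.
  choose p hp using fun k : ℕ => hsum (k + 1)
  let σ : ℕ → ℝ := fun k => ∑ i, U (p k) i
  have hσ : ∀ k : ℕ, (k : ℝ) + 1 < σ k := hp
  have hσ0 : ∀ k, 0 < σ k := fun k => lt_trans (by positivity) (hσ k)
  let v : ℕ → Fin n → ℝ := fun k => (σ k)⁻¹ • U (p k)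
  have hv0 : ∀ k i, 0 ≤ v k i := fun k i =>
    mul_nonneg (inv_nonneg.2 (hσ0 k).le) (hU0 _ i)
  have hv1 : ∀ k, ∑ i, v k i = 1 := fun k => by
    simp only [v, Pi.smul_apply, smul_eq_mul, ← Finset.mul_sum]
    exact inv_mul_cancel₀ (hσ0 k).ne'
  have hvmem : ∀ k, v k ∈ Set.Icc (0 : Fin n → ℝ) 1 := fun k =>
    ⟨fun i => hv0 k i, fun i => by
      rw [Pi.one_apply, ← hv1 k]
      exact Finset.single_le_sum (f := v k) (fun i _ => hv0 k i) (Finset.mem_univ i)⟩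
  obtain ⟨u, -, φ, hφ, hu⟩ := isCompact_Icc.tendsto_subseq hvmem
  have hui : ∀ i, Tendsto (fun k => v (φ k) i) atTop (𝓝 (u i)) := fun i =>
    (tendsto_pi_nhds.1 hu) i
  have hσt : Tendsto (fun k => (σ (φ k))⁻¹) atTop (𝓝 0) := by
    refine tendsto_inv_atTop_zero.comp ?_
    refine (tendsto_atTop_mono (fun k => ?_) tendsto_natCast_atTop_atTop : Tendsto σ atTop atTop).comp
      hφ.tendsto_atTop
    linarith [hσ k]
  refine ⟨u, fun i => ge_of_tendsto' (hui i) fun k => hv0 _ i, ?_, fun i => ?_⟩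
  · rintro rfl
    have h1 := tendsto_finsetSum Finset.univ fun i _ => hui i
    simp only [hv1] at h1
    simpa using tendsto_nhds_unique h1 tendsto_const_nhds
  · have h1 : Tendsto (fun k => θ * v (φ k) i - (σ (φ k))⁻¹) atTop (𝓝 (θ * u i - 0)) :=
      ((hui i).const_mul θ).sub hσt
    have h2 : Tendsto (fun k => (A *ᵥ v (φ k)) i) atTop (𝓝 ((A *ᵥ u) i)) :=
      tendsto_finsetSum Finset.univ fun j _ => (hui j).const_mul (A i j)
    rw [sub_zero] at h1
    refine le_of_tendsto_of_tendsto' h1 h2 fun k => ?_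
    have := hUA (p (φ k)) i
    simp only [v, Matrix.mulVec_smul, Pi.smul_apply, smul_eq_mul]
    have h3 := mul_le_mul_of_nonneg_left this (inv_nonneg.2 (hσ0 (φ k)).le)
    linarith

end Comparison

/-! ### Affine recursions with a nonnegative matrix. -/

section Recursion

open Matrix

variable {n : ℕ}

/-- Unrolling gives `V p ≤ b * ∑ A ^ m 1` over `m ≤ p`, where `b` bounds both the initial vector and
`c`. As `θ > 1`, the geometric series is comparable to its last term. -/
lemma sum_le_of_affine_recursion {A : Matrix (Fin n) (Fin n) ℝ} (hA : ∀ i j, 0 ≤ A i j)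
    {V : ℕ → Fin n → ℝ} {c : ℝ} (hV : ∀ p i, V (p + 1) i ≤ (A *ᵥ V p) i + c) {θ : ℝ}
    (hθ1 : 1 < θ) (hθ : matrixSpectralRadius A < θ) :
    ∃ C, 0 ≤ C ∧ ∀ p, ∑ i, V p i ≤ C * θ ^ p := by
  obtain ⟨C, hC0, hC⟩ := exists_entrySum_pow_le hA hθ
  obtain ⟨b, hb0, hbV, hbc⟩ : ∃ b, 0 ≤ b ∧ (∀ i, V 0 i ≤ b) ∧ c ≤ b := by
    refine ⟨|c| + ∑ i, |V 0 i|, by positivity, fun i => ?_, ?_⟩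
    · have := Finset.single_le_sum (f := fun i => |V 0 i|) (fun i _ => abs_nonneg _)
        (Finset.mem_univ i)
      have h2 := le_abs_self (V 0 i)
      have h3 := abs_nonneg c
      linarith
    · have : 0 ≤ ∑ i, |V 0 i| := by positivity
      linarith [le_abs_self c]
  let w : ℕ → Fin n → ℝ := fun p => (A ^ p) *ᵥ (fun _ => 1)
  have hwA : ∀ p, A *ᵥ w p = w (p + 1) := fun p => by
    simp only [w, Matrix.mulVec_mulVec, pow_succ']
  have hws : ∀ p, ∑ i, w p i = entrySum (A ^ p) := fun p => by
    simp [w, entrySum, Matrix.mulVec, dotProduct]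
  have key : ∀ p i, V p i ≤ b * ∑ m ∈ Finset.range (p + 1), w m i := by
    intro p
    induction p with
    | zero => intro i; simpa [w] using hbV i
    | succ p ih =>
      intro i
      have h1 : (A *ᵥ V p) i ≤ (A *ᵥ (b • ∑ m ∈ Finset.range (p + 1), w m)) i := by
        refine mulVec_mono_of_nonneg hA (fun j => ?_) i
        simpa using ih j
      rw [Matrix.mulVec_smul, Matrix.mulVec_sum] at h1
      simp only [hwA, Pi.smul_apply, Finset.sum_apply, smul_eq_mul] at h1
      rw [Finset.sum_range_succ', mul_add]
      have h2 : w 0 i = 1 := by simp [w]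
      rw [h2, mul_one]
      exact (hV p i).trans (add_le_add h1 hbc)
  have hθ0 : 0 < θ - 1 := sub_pos.2 hθ1
  refine ⟨b * (C * (θ / (θ - 1))), by positivity, fun p => ?_⟩
  calc ∑ i, V p i ≤ ∑ i, b * ∑ m ∈ Finset.range (p + 1), w m i :=
        Finset.sum_le_sum fun i _ => key p i
    _ = b * ∑ m ∈ Finset.range (p + 1), entrySum (A ^ m) := by
        rw [← Finset.mul_sum, Finset.sum_comm]; simp only [hws]
    _ ≤ b * ∑ m ∈ Finset.range (p + 1), C * θ ^ m := by
        gcongr with m; exact hC m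
    _ = b * (C * ((θ ^ (p + 1) - 1) / (θ - 1))) := by
        rw [← Finset.mul_sum, geom_sum_eq hθ1.ne']
    _ ≤ b * (C * (θ ^ (p + 1) / (θ - 1))) := by
        gcongr; linarith
    _ = _ := by rw [pow_succ]; ring

/-- With `η` between `θ` and the spectral radius and `η u ≤ A u`, the vectors `t θ ^ p u` are
subsolutions: the surplus `(η - θ) t θ ^ p u` pays for `c` on the support of `u`, and off it
nonnegativity of `V` suffices. -/
lemma le_sum_of_affine_recursion {A : Matrix (Fin n) (Fin n) ℝ} (hA : ∀ i j, 0 ≤ A i j)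
    {V : ℕ → Fin n → ℝ} (hV0 : ∀ p i, 0 ≤ V p i) {c : ℝ} (hc : 0 ≤ c)
    (hV : ∀ p i, (A *ᵥ V p) i - c ≤ V (p + 1) i)
    (hlarge : ∀ T, ∃ p, ∀ i, T ≤ V p i) {θ : ℝ} (hθ1 : 1 < θ)
    (hθ : θ < matrixSpectralRadius A) :
    ∃ C, 0 < C ∧ ∃ p₀, ∀ p, C * θ ^ p ≤ ∑ i, V (p₀ + p) i := by
  obtain ⟨η, hθη, hη⟩ := exists_between hθ
  have hη0 : 0 < η := by linarith
  obtain ⟨u, hu0, hune, hu⟩ := exists_superharmonic hA hη0 hη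
  obtain ⟨i₀, hi₀⟩ : ∃ i, u i ≠ 0 := by
    by_contra! h; exact hune (funext h)
  obtain ⟨μ, hμ0, hμ⟩ : ∃ μ, 0 < μ ∧ ∀ i, u i ≠ 0 → μ ≤ u i := by
    have hne : (Finset.univ.filter fun i => u i ≠ 0).Nonempty := ⟨i₀, by simp [hi₀]⟩
    obtain ⟨i, hi, hmin⟩ := Finset.exists_min_image _ u hne
    refine ⟨u i, lt_of_le_of_ne (hu0 i) (Ne.symm (Finset.mem_filter.1 hi).2), fun j hj => ?_⟩
    exact hmin j (by simp [hj])
  obtain ⟨B, hB⟩ : ∃ B, ∀ i, u i ≤ B :=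
    ⟨∑ i, u i, fun i => Finset.single_le_sum (fun i _ => hu0 i) (Finset.mem_univ i)⟩
  -- Chosen so that `t * (η - θ) * μ ≥ c`, where `μ` is the least positive coordinate of `u`.
  let t : ℝ := 1 + c / μ / (η - θ)
  have hηθ : 0 < η - θ := sub_pos.2 hθη
  have ht0 : 0 < t := by positivity
  have htc : c ≤ t * (η - θ) * μ := by
    have : c = c / μ / (η - θ) * (η - θ) * μ := by field_simp
    rw [this]
    gcongr
    simp only [t]; linarith
  obtain ⟨p₀, hp₀⟩ := hlarge (t * B)
  have key : ∀ p i, t * θ ^ p * u i ≤ V (p₀ + p) i := by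
    intro p
    induction p with
    | zero =>
      intro i
      rw [pow_zero, mul_one]
      exact (mul_le_mul_of_nonneg_left (hB i) ht0.le).trans (hp₀ i)
    | succ p ih =>
      intro i
      by_cases hi : u i = 0
      · rw [hi, mul_zero]; exact hV0 _ i
      have h1 : (A *ᵥ ((t * θ ^ p) • u)) i ≤ (A *ᵥ V (p₀ + p)) i :=
        mulVec_mono_of_nonneg hA ih i
      rw [Matrix.mulVec_smul, Pi.smul_apply, smul_eq_mul] at h1
      have h2 := mul_le_mul_of_nonneg_left (hu i) (by positivity : 0 ≤ t * θ ^ p)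
      have h3 := hV (p₀ + p) i
      have h4 : c ≤ t * θ ^ p * (η - θ) * u i := by
        have : (1 : ℝ) ≤ θ ^ p := one_le_pow₀ hθ1.le
        calc c ≤ t * (η - θ) * μ := htc
          _ ≤ t * (η - θ) * u i := by gcongr; exact hμ i hi
          _ ≤ t * (η - θ) * u i * θ ^ p := le_mul_of_one_le_right
              (mul_nonneg (by positivity) (hu0 i)) this
          _ = _ := by ring
      rw [← add_assoc, pow_succ]
      linarith
  refine ⟨t * u i₀, mul_pos ht0 (lt_of_le_of_ne (hu0 i₀) (Ne.symm hi₀)), p₀, fun p => ?_⟩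
  calc t * u i₀ * θ ^ p = t * θ ^ p * u i₀ := by ring
    _ ≤ V (p₀ + p) i₀ := key p i₀
    _ ≤ _ := Finset.single_le_sum (fun i _ => hV0 _ i) (Finset.mem_univ i₀)

end Recursion

/-! ### Scaling matrices -/

section ScalingMatrix

open Matrix

lemma sum_ite_div_eq {N n : ℕ} (hN : 0 < N) (ℓ : ℕ) (h : ∀ d : Fin N, ℓ * N + d < n) (g : Fin n → ℝ) :
    (∑ j : Fin n, if j.val / N = ℓ then g j else 0) = ∑ d : Fin N, g ⟨ℓ * N + d, h d⟩ := by
  rw [← Finset.sum_filter]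
  symm
  refine Finset.sum_bij (fun d _ => ⟨ℓ * N + d, h d⟩) ?_ ?_ ?_ ?_
  · intro d _
    simp only [Finset.mem_filter, Finset.mem_univ, true_and]
    rw [mul_comm, Nat.mul_add_div hN, Nat.div_eq_of_lt d.isLt, add_zero]
  · intro a _ b _ hab
    simp only [Fin.mk.injEq] at hab
    exact Fin.ext (by omega)
  · intro j hj
    simp only [Finset.mem_filter, Finset.mem_univ, true_and] at hj
    refine ⟨⟨j % N, Nat.mod_lt _ hN⟩, Finset.mem_univ _, Fin.ext ?_⟩
    simp only
    rw [← hj]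
    exact Nat.div_add_mod' j N
  · intro d _; rfl

variable {N k : ℕ}

lemma mul_add_lt_pow_succ {m r d : ℕ} (hr : r < N ^ m) (hd : d < N) : r * N + d < N ^ (m + 1) := by
  rw [pow_succ]
  calc r * N + d < r * N + N := by omega
    _ = (r + 1) * N := by ring
    _ ≤ N ^ m * N := Nat.mul_le_mul_right _ hr

/-- In quotient form the column window says that the parent of `j` is the position of row `r` inside
its block, which suits sums over children. -/
lemma scalingMatrix_apply (hN : 0 < N) (s : Fin N → Fin (N ^ (k + 1)) → ℝ)
    (r j : Fin (N ^ (k + 1))) :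
    scalingMatrix N k s r j = if j.val / N = r.val % N ^ k then
      s ⟨r.val / N ^ k, Nat.div_lt_of_lt_mul (lt_of_lt_of_eq r.isLt (pow_succ N k))⟩ j else 0 := by
  simp only [scalingMatrix, Matrix.of_apply]
  congr 1
  rw [eq_iff_iff, Nat.div_eq_iff hN]
  constructor
  · rintro ⟨h1, h2⟩
    refine ⟨h1, ?_⟩
    rw [add_mul] at h2
    omega
  · rintro ⟨h1, h2⟩
    refine ⟨h1, ?_⟩
    rw [add_mul]
    omega

lemma scalingMatrix_nonneg {s : Fin N → Fin (N ^ (k + 1)) → ℝ} (hs : ∀ i j, 0 ≤ s i j)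
    (r j : Fin (N ^ (k + 1))) : 0 ≤ scalingMatrix N k s r j := by
  simp only [scalingMatrix, Matrix.of_apply]
  split_ifs
  exacts [hs _ _, le_rfl]

lemma scalingMatrix_mono {s t : Fin N → Fin (N ^ (k + 1)) → ℝ} (hst : ∀ i j, s i j ≤ t i j)
    (r j : Fin (N ^ (k + 1))) : scalingMatrix N k s r j ≤ scalingMatrix N k t r j := by
  simp only [scalingMatrix, Matrix.of_apply]
  split_ifs
  exacts [hst _ _, le_rfl]

lemma mod_pow_lt (hN : 0 < N) (r : ℕ) : r % N ^ k < N ^ k := Nat.mod_lt _ (pow_pos hN k)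

lemma scalingMatrix_mulVec (hN : 0 < N) (s : Fin N → Fin (N ^ (k + 1)) → ℝ)
    (v : Fin (N ^ (k + 1)) → ℝ) (r : Fin (N ^ (k + 1))) :
    (scalingMatrix N k s *ᵥ v) r = ∑ d : Fin N,
      s ⟨r.val / N ^ k, Nat.div_lt_of_lt_mul (lt_of_lt_of_eq r.isLt (pow_succ N k))⟩
        ⟨r.val % N ^ k * N + d, mul_add_lt_pow_succ (mod_pow_lt hN _) d.isLt⟩ *
      v ⟨r.val % N ^ k * N + d, mul_add_lt_pow_succ (mod_pow_lt hN _) d.isLt⟩ := by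
  simp only [Matrix.mulVec, dotProduct, scalingMatrix_apply hN, ite_mul, zero_mul]
  exact sum_ite_div_eq hN _ _ _

/-- The matrix that adds up the entries of a vector over the `N` children of each index. -/
def childMatrix (N m : ℕ) : Matrix (Fin (N ^ m)) (Fin (N ^ (m + 1))) ℝ :=
  Matrix.of fun j j' => if j'.val / N = j.val then 1 else 0

/-- The parent of an index of level `m + 1`. -/
def parentIdx {m : ℕ} (j : Fin (N ^ (m + 1))) : Fin (N ^ m) :=
  ⟨j.val / N, Nat.div_lt_of_lt_mul (lt_of_lt_of_eq j.isLt (by rw [pow_succ, mul_comm]))⟩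

lemma childMatrix_nonneg {m : ℕ} (i : Fin (N ^ m)) (j : Fin (N ^ (m + 1))) :
    0 ≤ childMatrix N m i j := by
  simp only [childMatrix, Matrix.of_apply]; split_ifs <;> norm_num

lemma childMatrix_row_sum (hN : 0 < N) {m : ℕ} (i : Fin (N ^ m)) : ∑ j, childMatrix N m i j = N := by
  simp only [childMatrix, Matrix.of_apply]
  rw [sum_ite_div_eq hN i.val (fun d => mul_add_lt_pow_succ i.isLt d.isLt) (fun _ => 1)]
  simp

lemma childMatrix_apply {m : ℕ} (i : Fin (N ^ m)) (j : Fin (N ^ (m + 1))) :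
    childMatrix N m i j = if i = parentIdx j then 1 else 0 := by
  simp only [childMatrix, Matrix.of_apply, parentIdx, Fin.ext_iff, eq_comm]

lemma childMatrix_col_sum {m : ℕ} (j : Fin (N ^ (m + 1))) : ∑ i, childMatrix N m i j = 1 := by
  simp [childMatrix_apply]

/-- This product and the one in `childMatrix_mul_scalingMatrix` have the same support, fixed by the
grandparent of `j`. They differ only in whether the coefficient is read at the parent of `j` or at
`j` itself, so the intertwining inequality reduces to comparing `s` with `t`. -/
lemma scalingMatrix_mul_childMatrix (hN : 0 < N) (s : Fin N → Fin (N ^ (k + 1)) → ℝ)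
    (r : Fin (N ^ (k + 1))) (j : Fin (N ^ (k + 1 + 1))) :
    (scalingMatrix N k s * childMatrix N (k + 1)) r j =
      if j.val / N / N = r.val % N ^ k then
        s ⟨r.val / N ^ k, Nat.div_lt_of_lt_mul (lt_of_lt_of_eq r.isLt (pow_succ N k))⟩
          (parentIdx j) else 0 := by
  simp only [Matrix.mul_apply, childMatrix_apply, mul_ite, mul_one, mul_zero, Finset.sum_ite_eq',
    Finset.mem_univ, if_true, scalingMatrix_apply hN]
  rfl

lemma childMatrix_mul_scalingMatrix (hN : 0 < N) (s : Fin N → Fin (N ^ (k + 1 + 1)) → ℝ)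
    (r : Fin (N ^ (k + 1))) (j : Fin (N ^ (k + 1 + 1))) :
    (childMatrix N (k + 1) * scalingMatrix N (k + 1) s) r j =
      if j.val / N / N = r.val % N ^ k then
        s ⟨r.val / N ^ k, Nat.div_lt_of_lt_mul (lt_of_lt_of_eq r.isLt (pow_succ N k))⟩ j
          else 0 := by
  have hmod : ∀ d : Fin N, (r.val * N + d) % N ^ (k + 1) = r.val % N ^ k * N + d := fun d => by
    have h1 : r.val * N + d = r.val % N ^ k * N + d + N ^ (k + 1) * (r.val / N ^ k) := by
      conv_lhs => rw [← Nat.mod_add_div r.val (N ^ k)]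
      ring
    rw [h1, Nat.add_mul_mod_self_left,
      Nat.mod_eq_of_lt (mul_add_lt_pow_succ (mod_pow_lt hN _) d.isLt)]
  have hdiv : ∀ d : Fin N, (r.val * N + d) / N ^ (k + 1) = r.val / N ^ k := fun d => by
    generalize r.val = r'
    rw [pow_succ', ← Nat.div_div_eq_div_mul, mul_comm, Nat.mul_add_div hN,
      Nat.div_eq_of_lt d.isLt, add_zero]
  simp only [Matrix.mul_apply, childMatrix, Matrix.of_apply, ite_mul, one_mul, zero_mul]
  rw [sum_ite_div_eq hN r.val (fun d => mul_add_lt_pow_succ r.isLt d.isLt)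
    (fun x => scalingMatrix N (k + 1) s x j)]
  simp only [scalingMatrix_apply hN, hmod, hdiv]
  split_ifs with h
  -- Only the child `d` of `r` given by the last base-`N` digit of the parent of `j` contributes.
  · rw [Finset.sum_eq_single (⟨j.val / N % N, Nat.mod_lt _ hN⟩ : Fin N)]
    · rw [if_pos]
      rw [← h]
      exact (Nat.div_add_mod' _ _).symm
    · intro d _ hd
      rw [if_neg]
      intro h2
      apply hd
      apply Fin.ext
      simp only
      rw [h2, mul_comm, Nat.mul_add_mod, Nat.mod_eq_of_lt d.isLt]
    · simp
  · refine Finset.sum_eq_zero fun d _ => if_neg fun h2 => h ?_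
    rw [h2, mul_comm, Nat.mul_add_div hN, Nat.div_eq_of_lt d.isLt, add_zero]

lemma matrixSpectralRadius_scalingMatrix_antitone (hN : 0 < N)
    {s : Fin N → Fin (N ^ (k + 1)) → ℝ} {t : Fin N → Fin (N ^ (k + 1 + 1)) → ℝ}
    (hs : ∀ i j, 0 ≤ s i j) (ht : ∀ i j, 0 ≤ t i j) (h : ∀ i j, t i j ≤ s i (parentIdx j)) :
    matrixSpectralRadius (scalingMatrix N (k + 1) t) ≤
      matrixSpectralRadius (scalingMatrix N k s) := by
  refine matrixSpectralRadius_le_of_intertwine (scalingMatrix_nonneg hs) (scalingMatrix_nonneg ht)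
    (childMatrix N (k + 1)) childMatrix_nonneg N (childMatrix_row_sum hN) childMatrix_col_sum
    fun r j => ?_
  rw [scalingMatrix_mul_childMatrix hN, childMatrix_mul_scalingMatrix hN]
  split_ifs
  exacts [h _ _, le_rfl]

lemma matrixSpectralRadius_scalingMatrix_monotone (hN : 0 < N)
    {s : Fin N → Fin (N ^ (k + 1)) → ℝ} {t : Fin N → Fin (N ^ (k + 1 + 1)) → ℝ}
    (hs : ∀ i j, 0 ≤ s i j) (ht : ∀ i j, 0 ≤ t i j) (h : ∀ i j, s i (parentIdx j) ≤ t i j) :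
    matrixSpectralRadius (scalingMatrix N k s) ≤
      matrixSpectralRadius (scalingMatrix N (k + 1) t) := by
  refine le_matrixSpectralRadius_of_intertwine (scalingMatrix_nonneg hs) (scalingMatrix_nonneg ht)
    (childMatrix N (k + 1)) childMatrix_nonneg N (by positivity) (childMatrix_row_sum hN)
    childMatrix_col_sum fun r j => ?_
  rw [scalingMatrix_mul_childMatrix hN, childMatrix_mul_scalingMatrix hN]
  split_ifs
  exacts [h _ _, le_rfl]

end ScalingMatrix

/-! ### Functions of bounded variation -/

section Variation

open Set

/-- Increments dominated pointwise have dominated variation sums. Three terms are what solving the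
functional equation for the increment of `F` produces. -/
lemma BoundedVariationOn.of_abs_sub_le {f g₁ g₂ g₃ : ℝ → ℝ} {s : Set ℝ} {c₁ c₂ c₃ : ℝ}
    (h₁ : BoundedVariationOn g₁ s) (h₂ : BoundedVariationOn g₂ s) (h₃ : BoundedVariationOn g₃ s)
    (hc₁ : 0 ≤ c₁) (hc₂ : 0 ≤ c₂) (hc₃ : 0 ≤ c₃)
    (h : ∀ x ∈ s, ∀ y ∈ s,
      |f x - f y| ≤ c₁ * |g₁ x - g₁ y| + c₂ * |g₂ x - g₂ y| + c₃ * |g₃ x - g₃ y|) :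
    BoundedVariationOn f s := by
  have hle : eVariationOn f s ≤ ENNReal.ofReal c₁ * eVariationOn g₁ s +
      ENNReal.ofReal c₂ * eVariationOn g₂ s + ENNReal.ofReal c₃ * eVariationOn g₃ s := by
    refine iSup_le fun ⟨n, u, hu, us⟩ => ?_
    have : ∀ i, edist (f (u (i + 1))) (f (u i)) ≤
        ENNReal.ofReal c₁ * edist (g₁ (u (i + 1))) (g₁ (u i)) +
        ENNReal.ofReal c₂ * edist (g₂ (u (i + 1))) (g₂ (u i)) +
        ENNReal.ofReal c₃ * edist (g₃ (u (i + 1))) (g₃ (u i)) := fun i => by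
      simp only [edist_dist, Real.dist_eq]
      rw [← ENNReal.ofReal_mul hc₁, ← ENNReal.ofReal_mul hc₂, ← ENNReal.ofReal_mul hc₃,
        ← ENNReal.ofReal_add (by positivity) (by positivity),
        ← ENNReal.ofReal_add (by positivity) (by positivity)]
      exact ENNReal.ofReal_le_ofReal (h _ (us _) _ (us _))
    refine (Finset.sum_le_sum fun i _ => this i).trans ?_
    rw [Finset.sum_add_distrib, Finset.sum_add_distrib, ← Finset.mul_sum, ← Finset.mul_sum,
      ← Finset.mul_sum]
    gcongr <;> exact eVariationOn.sum_le hu us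
  refine ne_top_of_le_ne_top ?_ hle
  exact ENNReal.add_ne_top.2 ⟨ENNReal.add_ne_top.2 ⟨ENNReal.mul_ne_top ENNReal.ofReal_ne_top h₁,
    ENNReal.mul_ne_top ENNReal.ofReal_ne_top h₂⟩, ENNReal.mul_ne_top ENNReal.ofReal_ne_top h₃⟩

lemma BoundedVariationOn.add_real {f g : ℝ → ℝ} {s : Set ℝ} (hf : BoundedVariationOn f s)
    (hg : BoundedVariationOn g s) : BoundedVariationOn (fun t => f t + g t) s := by
  refine BoundedVariationOn.of_abs_sub_le (c₁ := 1) (c₂ := 1) (c₃ := 0) hf hg hf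
    zero_le_one zero_le_one le_rfl fun x _ y _ => ?_
  rw [one_mul, one_mul, zero_mul, add_zero, add_sub_add_comm]
  exact abs_add_le _ _

lemma BoundedVariationOn.exists_abs_le {f : ℝ → ℝ} {s : Set ℝ} (hf : BoundedVariationOn f s) :
    ∃ B, 0 ≤ B ∧ ∀ t ∈ s, |f t| ≤ B := by
  rcases s.eq_empty_or_nonempty with rfl | ⟨x, hx⟩
  · exact ⟨0, le_rfl, by simp⟩
  · refine ⟨|f x| + (eVariationOn f s).toReal, by positivity, fun t ht => ?_⟩
    have h1 := hf.dist_le ht hx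
    rw [Real.dist_eq] at h1
    have h2 := abs_add_le (f t - f x) (f x)
    rw [sub_add_cancel] at h2
    linarith

lemma BoundedVariationOn.mul_real {f g : ℝ → ℝ} {s : Set ℝ} (hf : BoundedVariationOn f s)
    (hg : BoundedVariationOn g s) : BoundedVariationOn (fun t => f t * g t) s := by
  obtain ⟨A, hA0, hA⟩ := hf.exists_abs_le
  obtain ⟨B, hB0, hB⟩ := hg.exists_abs_le
  refine BoundedVariationOn.of_abs_sub_le (c₁ := B) (c₂ := A) (c₃ := 0) hf hg hf
    hB0 hA0 le_rfl fun x hx y hy => ?_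
  have h1 : f x * g x - f y * g y = (f x - f y) * g x + f y * (g x - g y) := by ring
  rw [h1, zero_mul, add_zero]
  refine (abs_add_le _ _).trans ?_
  rw [abs_mul, abs_mul, mul_comm]
  gcongr
  exacts [hB x hx, hA y hy]

lemma BoundedVariationOn.sum_abs_sub_le {g : ℝ → ℝ} {s : Set ℝ} (hg : BoundedVariationOn g s)
    {n : ℕ} {u : ℕ → ℝ} (hu : Monotone u) (us : ∀ i ≤ n, u i ∈ s) :
    ∑ i ∈ Finset.range n, |g (u (i + 1)) - g (u i)| ≤ (eVariationOn g s).toReal := by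
  have h := eVariationOn.sum_le_of_monotoneOn_Iic (f := g) (s := s) (n := n) (u := u)
    (hu.monotoneOn _) us
  have h2 := ENNReal.toReal_mono hg h
  rw [ENNReal.toReal_sum fun i _ => edist_ne_top _ _] at h2
  simpa only [edist_dist, Real.dist_eq, ENNReal.toReal_ofReal (abs_nonneg _)] using h2

/-- The step functions `t ↦ f(⌊tM⌋/M)` converge to `f` by continuity, and the variation is lower
semicontinuous. The variation of such a step function is at most the sum of increments over the
grid. -/
lemma tendsto_sum_increments_unit {f : ℝ → ℝ} (hf : ContinuousOn f (Icc 0 1))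
    (h : eVariationOn f (Icc 0 1) = ⊤) :
    Tendsto (fun M : ℕ => ∑ j ∈ Finset.range M, |f (((j : ℝ) + 1) / M) - f (j / M)|)
      atTop atTop := by
  have hmem : ∀ t ∈ Icc (0 : ℝ) 1, ∀ M : ℕ, 0 < M → ⌊t * M⌋₊ ≤ M := fun t ht M hM => by
    have : t * M ≤ M := mul_le_of_le_one_left (by positivity) ht.2
    exact_mod_cast (Nat.floor_le (mul_nonneg ht.1 (by positivity))).trans this
  have hpt : ∀ t ∈ Icc (0 : ℝ) 1,
      Tendsto (fun M : ℕ => f ((⌊t * M⌋₊ : ℝ) / M)) atTop (𝓝 (f t)) := fun t ht => by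
    have h1 : Tendsto (fun M : ℕ => (⌊t * M⌋₊ : ℝ) / M) atTop (𝓝[Icc 0 1] t) := by
      refine tendsto_nhdsWithin_iff.2
        ⟨(tendsto_nat_floor_mul_div_atTop ht.1).comp tendsto_natCast_atTop_atTop, ?_⟩
      filter_upwards [eventually_gt_atTop 0] with M hM
      have : (⌊t * M⌋₊ : ℝ) ≤ M := by exact_mod_cast hmem t ht M hM
      exact ⟨by positivity, div_le_one_of_le₀ this (by positivity)⟩
    exact (hf t ht).tendsto.comp h1
  refine tendsto_atTop.2 fun v => ?_
  have h1 := eVariationOn.lowerSemicontinuous_aux hpt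
    (h ▸ ENNReal.ofReal_lt_top : ENNReal.ofReal v < eVariationOn f (Icc 0 1))
  filter_upwards [h1, eventually_gt_atTop 0] with M hM hM0
  have hmono : Monotone fun j : ℕ => (j : ℝ) / M := fun a b hab => by
    simp only; gcongr
  have h2 : eVariationOn (f ∘ fun t : ℝ => (⌊t * M⌋₊ : ℝ) / M) (Icc 0 1) ≤
      eVariationOn f ((fun j : ℕ => (j : ℝ) / M) '' Iic M) := by
    refine eVariationOn.comp_le_of_monotoneOn f _ (fun a _ b _ hab => ?_)
      fun t ht => ⟨_, hmem t ht M hM0, rfl⟩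
    gcongr
  rw [eVariationOn.image_range_of_monotone f hmono] at h2
  have h3 := (hM.trans_le h2).le
  simp only [edist_dist, Real.dist_eq] at h3
  rw [← ENNReal.ofReal_sum_of_nonneg fun i _ => abs_nonneg _,
    ENNReal.ofReal_le_ofReal_iff (Finset.sum_nonneg fun i _ => abs_nonneg _)] at h3
  refine h3.trans (le_of_eq (Finset.sum_congr rfl fun j _ => ?_))
  rw [abs_sub_comm]
  push_cast
  rfl

lemma image_affine_unit {a b : ℝ} (hab : a < b) :
    (fun t : ℝ => a + t * (b - a)) '' Icc 0 1 = Icc a b := by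
  have hba : 0 < b - a := sub_pos.2 hab
  ext y
  constructor
  · rintro ⟨t, ht, rfl⟩
    constructor
    · have := mul_nonneg ht.1 hba.le; simp only; linarith
    · have := mul_le_of_le_one_left hba.le ht.2; simp only; linarith
  · intro hy
    refine ⟨(y - a) / (b - a), ⟨div_nonneg (by linarith [hy.1]) hba.le,
      div_le_one_of_le₀ (by linarith [hy.2]) hba.le⟩, ?_⟩
    simp only
    field_simp
    ring

lemma tendsto_sum_increments {f : ℝ → ℝ} {a b : ℝ} (hab : a < b) (hf : ContinuousOn f (Icc a b))
    (h : eVariationOn f (Icc a b) = ⊤) :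
    Tendsto (fun M : ℕ => ∑ j ∈ Finset.range M,
      |f (a + ((j : ℝ) + 1) / M * (b - a)) - f (a + j / M * (b - a))|) atTop atTop := by
  have hba : 0 < b - a := sub_pos.2 hab
  have himg := image_affine_unit hab
  have hmono : Monotone fun t : ℝ => a + t * (b - a) := fun x y hxy => by
    simp only; gcongr
  refine tendsto_sum_increments_unit (f := f ∘ fun t : ℝ => a + t * (b - a)) ?_ ?_
  · exact hf.comp (by fun_prop) (himg ▸ mapsTo_image _ _)
  · rw [eVariationOn.comp_eq_of_monotoneOn f _ (hmono.monotoneOn _), himg, h]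

end Variation

lemma sum_range_mul_eq {M : Type*} [AddCommMonoid M] (g : ℕ → M) (a b : ℕ) :
    ∑ c ∈ Finset.range (a * b), g c =
      ∑ r ∈ Finset.range a, ∑ s ∈ Finset.range b, g (r * b + s) := by
  induction a with
  | zero => simp
  | succ a ih => rw [add_mul, one_mul, Finset.sum_range_add, ih, Finset.sum_range_succ]

/-! ### Self-affine functions on the unit interval -/

/-- Data of a self-affine functional equation `F((i + t)/N) = S_i(t) F(t) + q_i(t)`, `i < N`,
on `[0, 1]` with coefficients of bounded variation. -/
structure SelfAffine (F : ℝ → ℝ) (N : ℕ) where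
  S : ℕ → ℝ → ℝ
  q : ℕ → ℝ → ℝ
  pos : 0 < N
  continuousOn_F : ContinuousOn F (Set.Icc 0 1)
  continuousOn_S : ∀ i < N, ContinuousOn (S i) (Set.Icc 0 1)
  bv_S : ∀ i < N, BoundedVariationOn (S i) (Set.Icc 0 1)
  bv_q : ∀ i < N, BoundedVariationOn (q i) (Set.Icc 0 1)
  map_eq : ∀ i < N, ∀ t ∈ Set.Icc (0 : ℝ) 1, F (((i : ℝ) + t) / N) = S i t * F t + q i t

namespace SelfAffine

open Set

lemma child_mem {N i : ℕ} (hi : i < N) {t : ℝ} (ht : t ∈ Icc (0 : ℝ) 1) :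
    ((i : ℝ) + t) / N ∈ Icc (0 : ℝ) 1 := by
  have h0 : (0 : ℝ) < N := by exact_mod_cast (by omega : 0 < N)
  have h1 : (i : ℝ) + 1 ≤ N := by exact_mod_cast hi
  refine ⟨div_nonneg (by linarith [ht.1, (Nat.cast_nonneg i : (0 : ℝ) ≤ i)]) h0.le, ?_⟩
  rw [div_le_one h0]
  linarith [ht.2]

lemma child_mono (N i : ℕ) : Monotone fun t : ℝ => ((i : ℝ) + t) / N := fun a b hab => by
  simp only; gcongr

lemma bv_comp_child {N i : ℕ} (hi : i < N) {g : ℝ → ℝ} (hg : BoundedVariationOn g (Icc 0 1)) :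
    BoundedVariationOn (fun t => g (((i : ℝ) + t) / N)) (Icc 0 1) :=
  ne_top_of_le_ne_top hg (eVariationOn.comp_le_of_monotoneOn g _ ((child_mono N i).monotoneOn _)
    fun _ ht => child_mem hi ht)

lemma continuousOn_comp_child {N i : ℕ} (hi : i < N) {g : ℝ → ℝ} (hg : ContinuousOn g (Icc 0 1)) :
    ContinuousOn (fun t => g (((i : ℝ) + t) / N)) (Icc 0 1) :=
  hg.comp (f := fun t : ℝ => ((i : ℝ) + t) / N) (by fun_prop) fun _ ht => child_mem hi ht

variable {F : ℝ → ℝ} {N M : ℕ}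

/-- Composition of two functional equations. -/
noncomputable def comp (A : SelfAffine F N) (B : SelfAffine F M) : SelfAffine F (N * M) where
  S j t := A.S (j / M) ((((j % M : ℕ) : ℝ) + t) / M) * B.S (j % M) t
  q j t := A.S (j / M) ((((j % M : ℕ) : ℝ) + t) / M) * B.q (j % M) t +
    A.q (j / M) ((((j % M : ℕ) : ℝ) + t) / M)
  pos := Nat.mul_pos A.pos B.pos
  continuousOn_F := A.continuousOn_F
  continuousOn_S j hj := (continuousOn_comp_child (Nat.mod_lt _ B.pos)
    (A.continuousOn_S _ (Nat.div_lt_of_lt_mul (by rwa [mul_comm])))).mul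
    (B.continuousOn_S _ (Nat.mod_lt _ B.pos))
  bv_S j hj := (bv_comp_child (Nat.mod_lt _ B.pos)
    (A.bv_S _ (Nat.div_lt_of_lt_mul (by rwa [mul_comm])))).mul_real
    (B.bv_S _ (Nat.mod_lt _ B.pos))
  bv_q j hj := ((bv_comp_child (Nat.mod_lt _ B.pos)
    (A.bv_S _ (Nat.div_lt_of_lt_mul (by rwa [mul_comm])))).mul_real
    (B.bv_q _ (Nat.mod_lt _ B.pos))).add_real (bv_comp_child (Nat.mod_lt _ B.pos)
    (A.bv_q _ (Nat.div_lt_of_lt_mul (by rwa [mul_comm]))))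
  map_eq j hj t ht := by
    have hN : (0 : ℝ) < N := by exact_mod_cast A.pos
    have hM : (0 : ℝ) < M := by exact_mod_cast B.pos
    have hj' : ((j : ℝ) + t) / ((N * M : ℕ) : ℝ) =
        (((j / M : ℕ) : ℝ) + (((j % M : ℕ) : ℝ) + t) / M) / N := by
      have : (j : ℝ) = M * ((j / M : ℕ) : ℝ) + ((j % M : ℕ) : ℝ) := by
        exact_mod_cast (Nat.div_add_mod j M).symm
      rw [this]
      push_cast
      field_simp
      ring
    rw [hj', A.map_eq _ (Nat.div_lt_of_lt_mul (by rwa [mul_comm])) _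
      (child_mem (Nat.mod_lt _ B.pos) ht), B.map_eq _ (Nat.mod_lt _ B.pos) t ht]
    ring

/-- The trivial functional equation `F = 1 * F + 0`. -/
noncomputable def trivial (hF : ContinuousOn F (Icc 0 1)) : SelfAffine F 1 where
  S _ _ := 1
  q _ _ := 0
  pos := one_pos
  continuousOn_F := hF
  continuousOn_S _ _ := continuousOn_const
  bv_S _ _ := by simp [BoundedVariationOn, eVariationOn]
  bv_q _ _ := by simp [BoundedVariationOn, eVariationOn]
  map_eq i hi t _ := by
    obtain rfl : i = 0 := by omega
    simp

/-- Under composition the coefficients multiply, after precomposition with injective affine maps.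
This gives the bound `s ^ n` and keeps the zero sets finite. -/
lemma exists_iterate (A : SelfAffine F N) {s : ℝ} (hs : ∀ i < N, ∀ t ∈ Icc (0 : ℝ) 1, |A.S i t| ≤ s)
    (n : ℕ) : ∃ B : SelfAffine F (N ^ n),
      (∀ i < N ^ n, ∀ t ∈ Icc (0 : ℝ) 1, |B.S i t| ≤ s ^ n) ∧
      ((∀ i < N, {t ∈ Icc (0 : ℝ) 1 | A.S i t = 0}.Finite) →
        ∀ i < N ^ n, {t ∈ Icc (0 : ℝ) 1 | B.S i t = 0}.Finite) := by
  induction n with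
  | zero =>
    rw [pow_zero]
    exact ⟨trivial A.continuousOn_F, fun i _ t _ => by simp [trivial], fun _ i _ => by
      simp [trivial]⟩
  | succ n ih =>
    obtain ⟨B, hB, hBz⟩ := ih
    rw [pow_succ']
    refine ⟨A.comp B, fun i hi t ht => ?_, fun hz i hi => ?_⟩
    · have h1 : i / N ^ n < N := Nat.div_lt_of_lt_mul (by rwa [mul_comm])
      have h2 := Nat.mod_lt i B.pos
      simp only [comp, abs_mul]
      rw [pow_succ']
      exact mul_le_mul (hs _ h1 _ (child_mem h2 ht)) (hB _ h2 t ht) (abs_nonneg _)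
        ((abs_nonneg _).trans (hs _ h1 _ (child_mem h2 ht)))
    · have h1 : i / N ^ n < N := Nat.div_lt_of_lt_mul (by rwa [mul_comm])
      have h2 := Nat.mod_lt i B.pos
      have h3 : (0 : ℝ) < (N ^ n : ℕ) := by exact_mod_cast B.pos
      refine (((hz _ h1).preimage (f := fun t : ℝ => (((i % N ^ n : ℕ) : ℝ) + t) / (N ^ n : ℕ))
        ?_).union (hBz hz _ h2)).subset ?_
      · intro a _ b _ hab
        simp only at hab
        rw [div_left_inj' h3.ne'] at hab
        linarith
      · rintro t ⟨ht, h0⟩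
        simp only [comp, mul_eq_zero] at h0
        rcases h0 with h0 | h0
        · exact Or.inl ⟨child_mem h2 ht, h0⟩
        · exact Or.inr ⟨ht, h0⟩

/-- Points of `[0, 1]` all of whose neighbourhoods carry infinite variation of `F`. -/
def singularSet (F : ℝ → ℝ) : Set ℝ :=
  {x ∈ Icc (0 : ℝ) 1 | ∀ δ > 0, eVariationOn F (Icc 0 1 ∩ Icc (x - δ) (x + δ)) = ⊤}

lemma exists_abs_F_le (A : SelfAffine F N) : ∃ B, 0 ≤ B ∧ ∀ t ∈ Icc (0 : ℝ) 1, |F t| ≤ B := by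
  obtain ⟨B, hB⟩ := isCompact_Icc.exists_bound_of_continuousOn A.continuousOn_F
  exact ⟨B, (norm_nonneg _).trans (hB 0 (by simp)), hB⟩

/-- Near `x` the factor `S_i` stays away from `0`, so the functional equation can be solved for the
increments of `F`. Bounded variation on the copy would then give bounded variation of `F` near `x`.
-/
lemma eVariationOn_comp_child_eq_top (A : SelfAffine F N) {i : ℕ} (hi : i < N) {x : ℝ}
    (hx : x ∈ singularSet F) (hS : A.S i x ≠ 0) {δ : ℝ} (hδ : 0 < δ) :
    eVariationOn (F ∘ fun t : ℝ => ((i : ℝ) + t) / N) (Icc 0 1 ∩ Icc (x - δ) (x + δ)) = ⊤ := by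
  by_contra hne
  have hcont := (A.continuousOn_S i hi x hx.1).abs
  have hc : 0 < |A.S i x| / 2 := by positivity
  have hev : ∀ᶠ t in 𝓝[Icc 0 1] x, |A.S i x| / 2 < |A.S i t| :=
    hcont.eventually (lt_mem_nhds (by linarith))
  obtain ⟨ε, hε, hball⟩ := Metric.mem_nhdsWithin_iff.1 hev
  let η := min δ (ε / 2)
  have hη : 0 < η := lt_min hδ (by positivity)
  have hlow : ∀ t ∈ Icc (0 : ℝ) 1 ∩ Icc (x - η) (x + η), |A.S i x| / 2 < |A.S i t| := by
    rintro t ⟨ht, ht2⟩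
    refine hball ⟨?_, ht⟩
    rw [Metric.mem_ball, Real.dist_eq, abs_lt]
    have : η ≤ ε / 2 := min_le_right _ _
    constructor <;> linarith [ht2.1, ht2.2]
  obtain ⟨B, hB0, hB⟩ := A.exists_abs_F_le
  refine absurd (hx.2 η hη) (BoundedVariationOn.of_abs_sub_le (c₁ := (|A.S i x| / 2)⁻¹)
    (c₂ := (|A.S i x| / 2)⁻¹) (c₃ := (|A.S i x| / 2)⁻¹ * B)
    (g₁ := F ∘ fun t : ℝ => ((i : ℝ) + t) / N) (g₂ := A.q i) (g₃ := A.S i) ?_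
    ((A.bv_q i hi).mono inter_subset_left) ((A.bv_S i hi).mono inter_subset_left)
    (by positivity) (by positivity) (by positivity) fun u hu v hv => ?_)
  · have : η ≤ δ := min_le_left _ _
    exact BoundedVariationOn.mono hne (inter_subset_inter_right _ (Icc_subset_Icc (by linarith)
      (by linarith)))
  · have e : A.S i u * (F u - F v) = (F (((i : ℝ) + u) / N) - F (((i : ℝ) + v) / N)) -
        (A.q i u - A.q i v) - F v * (A.S i u - A.S i v) := by
      rw [A.map_eq i hi u hu.1, A.map_eq i hi v hv.1]; ring
    have h1 : |A.S i x| / 2 * |F u - F v| ≤ |F (((i : ℝ) + u) / N) - F (((i : ℝ) + v) / N)| +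
        |A.q i u - A.q i v| + B * |A.S i u - A.S i v| := by
      calc |A.S i x| / 2 * |F u - F v| ≤ |A.S i u| * |F u - F v| := by
            gcongr; exact (hlow u hu).le
        _ = |A.S i u * (F u - F v)| := (abs_mul _ _).symm
        _ ≤ _ := by
          rw [e]
          refine (abs_sub _ _).trans (add_le_add (abs_sub _ _) ?_)
          rw [abs_mul]
          gcongr
          exact hB v hv.1
    simp only [Function.comp]
    rw [mul_assoc, ← mul_add, ← mul_add]
    rw [← div_eq_inv_mul, le_div_iff₀ hc, mul_comm]
    exact h1

lemma child_mem_singularSet (A : SelfAffine F N) {i : ℕ} (hi : i < N) {x : ℝ}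
    (hx : x ∈ singularSet F) (hS : A.S i x ≠ 0) : ((i : ℝ) + x) / N ∈ singularSet F := by
  refine ⟨child_mem hi hx.1, fun δ hδ => ?_⟩
  rw [← top_le_iff, ← A.eVariationOn_comp_child_eq_top hi hx hS hδ]
  refine eVariationOn.comp_le_of_monotoneOn F _ ((child_mono N i).monotoneOn _) ?_
  rintro t ⟨ht, ht2⟩
  have hN : (1 : ℝ) ≤ N := by exact_mod_cast A.pos
  refine ⟨child_mem hi ht, ?_⟩
  have h1 : |t - x| ≤ δ := abs_le.2 ⟨by linarith [ht2.1], by linarith [ht2.2]⟩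
  have h2 : |((i : ℝ) + t) / N - ((i : ℝ) + x) / N| ≤ δ := by
    rw [← sub_div, add_sub_add_left_eq_sub, abs_div, Nat.abs_cast]
    exact (div_le_self (abs_nonneg _) hN).trans h1
  have := abs_le.1 h2
  constructor <;> linarith [this.1, this.2]

lemma eVariationOn_child_eq_top (A : SelfAffine F N) {i : ℕ} (hi : i < N) {x : ℝ}
    (hx : x ∈ singularSet F) (hS : A.S i x ≠ 0) :
    eVariationOn F (Icc ((i : ℝ) / N) (((i : ℝ) + 1) / N)) = ⊤ := by
  rw [← top_le_iff, ← A.eVariationOn_comp_child_eq_top hi hx hS one_pos]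
  refine eVariationOn.comp_le_of_monotoneOn F _ ((child_mono N i).monotoneOn _) ?_
  rintro t ⟨ht, -⟩
  constructor
  · simp only; gcongr; linarith [ht.1]
  · simp only; gcongr; exact ht.2

/-- Branches with `S_i x ≠ 0` send `x` to distinct singular points, so at most as many terms are
nonzero as there are singular points. -/
lemma sum_abs_S_le (A : SelfAffine F N) {s : ℝ} (hs : ∀ i < N, ∀ t ∈ Icc (0 : ℝ) 1, |A.S i t| ≤ s)
    (hK : (singularSet F).Finite) {x : ℝ} (hx : x ∈ singularSet F) :
    ∑ i ∈ Finset.range N, |A.S i x| ≤ (hK.toFinset.card : ℝ) * s := by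
  have hN : (0 : ℝ) < N := by exact_mod_cast A.pos
  have hs0 : 0 ≤ s := (abs_nonneg _).trans (hs 0 A.pos 0 (by simp))
  have hcard : ((Finset.range N).filter fun i => A.S i x ≠ 0).card ≤ hK.toFinset.card := by
    refine Finset.card_le_card_of_injOn (fun i : ℕ => ((i : ℝ) + x) / N) ?_ ?_
    · intro i hi
      have hi := Finset.mem_filter.1 (Finset.mem_coe.1 hi)
      simpa using A.child_mem_singularSet (Finset.mem_range.1 hi.1) hx hi.2
    · intro a _ b _ hab
      simp only at hab
      rw [div_left_inj' hN.ne'] at hab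
      exact_mod_cast add_right_cancel hab
  calc ∑ i ∈ Finset.range N, |A.S i x|
      = ∑ i ∈ (Finset.range N).filter fun i => A.S i x ≠ 0, |A.S i x| := by
        rw [Finset.sum_filter_of_ne]
        intro i _ h
        simpa using h
    _ ≤ ∑ _i ∈ (Finset.range N).filter fun i => A.S i x ≠ 0, s := by
        refine Finset.sum_le_sum fun i hi => hs i ?_ x hx.1
        simpa using (Finset.mem_filter.1 hi).1
    _ ≤ _ := by
        rw [Finset.sum_const, nsmul_eq_mul]
        gcongr

end SelfAffine

/-! ### Infinite variation spreads to every cell. -/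

namespace SelfAffine

open Set

variable {F : ℝ → ℝ} {N : ℕ}

/-- The sum of the absolute increments of `F` over the `M` equal parts of `[0, 1]`. -/
noncomputable def increments (F : ℝ → ℝ) (M : ℕ) : ℝ :=
  ∑ j ∈ Finset.range M, |F (((j : ℝ) + 1) / M) - F (j / M)|

lemma natCast_div_mem {c M : ℕ} (hM : 0 < M) (hc : c ≤ M) : (c : ℝ) / M ∈ Icc (0 : ℝ) 1 :=
  ⟨by positivity, div_le_one_of_le₀ (by exact_mod_cast hc) (by positivity)⟩

lemma natCast_div_mono (M : ℕ) : Monotone fun j : ℕ => (j : ℝ) / M := fun a b hab => by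
  simp only; gcongr

lemma increments_le_variation {g : ℝ → ℝ} (hg : BoundedVariationOn g (Icc 0 1)) {M : ℕ}
    (hM : 0 < M) : increments g M ≤ (eVariationOn g (Icc 0 1)).toReal := by
  have := hg.sum_abs_sub_le (n := M) (natCast_div_mono M) fun i hi => natCast_div_mem hM hi
  simpa [increments] using this

/-- The product rule on each of the `N` copies of a cell; the increments of `S_i` and `q_i` add up
to at most their total variations, so `C` does not depend on `M`. -/
lemma increments_mul_le (A : SelfAffine F N) : ∃ C, ∀ M, 0 < M → increments F (N * M) ≤
    ∑ c ∈ Finset.range M, (∑ i ∈ Finset.range N, |A.S i (c / M)|) *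
      |F (((c : ℝ) + 1) / M) - F (c / M)| + C := by
  obtain ⟨B, hB0, hB⟩ := A.exists_abs_F_le
  refine ⟨∑ i ∈ Finset.range N, (B * (eVariationOn (A.S i) (Icc 0 1)).toReal +
    (eVariationOn (A.q i) (Icc 0 1)).toReal), fun M hM => ?_⟩
  have hN0 : (0 : ℝ) < N := by exact_mod_cast A.pos
  have hM0 : (0 : ℝ) < M := by exact_mod_cast hM
  rw [increments, sum_range_mul_eq]
  simp only [Finset.sum_mul]
  rw [Finset.sum_comm (s := Finset.range M), ← Finset.sum_add_distrib]
  refine Finset.sum_le_sum fun i hi => ?_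
  have hi := Finset.mem_range.1 hi
  have h1 : ∀ c ∈ Finset.range M,
      |F ((((i * M + c : ℕ) : ℝ) + 1) / (N * M : ℕ)) - F (((i * M + c : ℕ) : ℝ) / (N * M : ℕ))| ≤
      |A.S i (c / M)| * |F (((c : ℝ) + 1) / M) - F (c / M)| +
      (B * |A.S i (((c : ℝ) + 1) / M) - A.S i (c / M)| +
        |A.q i (((c : ℝ) + 1) / M) - A.q i (c / M)|) := by
    intro c hc
    have hc := Finset.mem_range.1 hc
    have hm1 : ((c : ℝ) + 1) / M ∈ Icc (0 : ℝ) 1 := by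
      exact_mod_cast natCast_div_mem hM (c := c + 1) hc
    have hm0 : (c : ℝ) / M ∈ Icc (0 : ℝ) 1 := natCast_div_mem hM hc.le
    have e1 : (((i * M + c : ℕ) : ℝ) + 1) / (N * M : ℕ) = ((i : ℝ) + ((c : ℝ) + 1) / M) / N := by
      push_cast; field_simp; ring
    have e0 : (((i * M + c : ℕ) : ℝ)) / (N * M : ℕ) = ((i : ℝ) + (c : ℝ) / M) / N := by
      push_cast; field_simp
    rw [e1, e0, A.map_eq i hi _ hm1, A.map_eq i hi _ hm0]
    generalize ((c : ℝ) + 1) / M = v at *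
    generalize (c : ℝ) / M = u at *
    have e : A.S i v * F v + A.q i v - (A.S i u * F u + A.q i u) =
      A.S i u * (F v - F u) + F v * (A.S i v - A.S i u) + (A.q i v - A.q i u) := by ring
    rw [e, ← add_assoc]
    refine (abs_add_le _ _).trans (add_le_add ((abs_add_le _ _).trans ?_) le_rfl)
    rw [abs_mul, abs_mul]
    gcongr
    exact hB v hm1
  refine (Finset.sum_le_sum h1).trans ?_
  rw [Finset.sum_add_distrib, Finset.sum_add_distrib, ← Finset.mul_sum]
  gcongr
  · exact increments_le_variation (A.bv_S i hi) hM
  · exact increments_le_variation (A.bv_q i hi) hM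

/-- A Lebesgue number argument: cells shorter than the Lebesgue number of the cover lie in a single
member. -/
lemma exists_uniform_partition {P : Set ℝ → Prop} (hP : ∀ s t, s ⊆ t → P t → P s)
    (h : ∀ x ∈ Icc (0 : ℝ) 1, ∃ δ > 0, P (Icc 0 1 ∩ Icc (x - δ) (x + δ))) :
    ∃ M₀ : ℕ, ∀ M ≥ M₀, 0 < M → ∀ j < M, P (Icc ((j : ℝ) / M) (((j : ℝ) + 1) / M)) := by
  choose! r hr0 hr using h
  obtain ⟨δ, hδ, hball⟩ := lebesgue_number_lemma_of_metric (s := Icc (0 : ℝ) 1)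
    (c := fun x : Icc (0 : ℝ) 1 => Metric.ball x.1 (r x)) isCompact_Icc
    (fun _ => Metric.isOpen_ball) fun x hx => mem_iUnion.2 ⟨⟨x, hx⟩, Metric.mem_ball_self (hr0 x hx)⟩
  obtain ⟨M₀, hM₀⟩ := exists_nat_one_div_lt hδ
  refine ⟨M₀ + 1, fun M hM hMpos j hj => ?_⟩
  obtain ⟨⟨x, hx⟩, hxb⟩ := hball ((j : ℝ) / M) (natCast_div_mem hMpos hj.le)
  refine hP _ _ ?_ (hr x hx)
  intro t ht
  have hM0 : (0 : ℝ) < M := by exact_mod_cast hMpos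
  have hsmall : (1 : ℝ) / M < δ := by
    refine lt_of_le_of_lt ?_ hM₀
    gcongr
    exact_mod_cast hM
  have h1 : t ∈ Metric.ball x (r x) := hxb <| by
    rw [Metric.mem_ball, Real.dist_eq, abs_lt]
    have := ht.2
    rw [add_div] at this
    constructor <;> linarith [ht.1]
  rw [Metric.mem_ball, Real.dist_eq, abs_lt] at h1
  refine ⟨⟨le_trans (by positivity) ht.1, ht.2.trans ?_⟩, by linarith [h1.1], by linarith [h1.2]⟩
  exact_mod_cast (natCast_div_mem hMpos (c := j + 1) hj).2

/-- On a fine enough grid each cell either has `∑ |S_i| ≤ 1/2` or carries bounded variation of `F`.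
Refinement by `N` then halves the sum of increments up to a constant, so these sums stay bounded,
contrary to infinite variation. -/
lemma eVariationOn_ne_top_of_sum_lt (A : SelfAffine F N) (hN : 2 ≤ N)
    (h : ∀ x ∈ singularSet F, ∑ i ∈ Finset.range N, |A.S i x| < 1 / 2) :
    eVariationOn F (Icc 0 1) ≠ ⊤ := by
  intro htop
  let γ : ℝ → ℝ := fun t => ∑ i ∈ Finset.range N, |A.S i t|
  have hγc : ContinuousOn γ (Icc 0 1) :=
    continuousOn_finsetSum _ fun i hi => (A.continuousOn_S i (Finset.mem_range.1 hi)).abs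
  have hγ0 : ∀ t, 0 ≤ γ t := fun t => Finset.sum_nonneg fun i _ => abs_nonneg _
  obtain ⟨G, hG⟩ := isCompact_Icc.exists_bound_of_continuousOn hγc
  have hG0 : 0 ≤ G := (norm_nonneg _).trans (hG 0 (by simp))
  obtain ⟨M₀, hM₀⟩ := exists_uniform_partition
    (P := fun s => (∀ t ∈ s, γ t ≤ 1 / 2) ∨ BoundedVariationOn F s)
    (fun s t hst ht => ht.imp (fun h x hx => h x (hst hx)) fun h => h.mono hst) fun x hx => by
      by_cases hxs : x ∈ singularSet F
      · have hev : ∀ᶠ t in 𝓝[Icc 0 1] x, γ t < 1 / 2 :=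
          (hγc x hx).eventually (gt_mem_nhds (h x hxs))
        obtain ⟨ε, hε, hball⟩ := Metric.mem_nhdsWithin_iff.1 hev
        refine ⟨ε / 2, by positivity, Or.inl fun t ht => (hball ⟨?_, ht.1⟩).le⟩
        rw [Metric.mem_ball, Real.dist_eq, abs_lt]
        constructor <;> linarith [ht.2.1, ht.2.2]
      · have : ∃ δ > 0, eVariationOn F (Icc 0 1 ∩ Icc (x - δ) (x + δ)) ≠ ⊤ := by
          by_contra! hc
          exact hxs ⟨hx, hc⟩
        obtain ⟨δ, hδ, hv⟩ := this
        exact ⟨δ, hδ, Or.inr hv⟩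
  obtain ⟨m₀, hm₀⟩ : ∃ m₀ : ℕ, M₀ ≤ N ^ m₀ := ⟨M₀, (Nat.lt_pow_self (by omega)).le⟩
  have hcell := hM₀ (N ^ m₀) hm₀ (pow_pos A.pos _)
  obtain ⟨C, hC⟩ := A.increments_mul_le
  -- Bounds the contribution of the cells of bounded variation. On the other cells the summand uses
  -- `toReal` of a possibly infinite variation, which is harmless as it is nonnegative.
  let D : ℝ := ∑ j ∈ Finset.range (N ^ m₀), G * (eVariationOn F
    (Icc ((j : ℝ) / (N ^ m₀ : ℕ)) (((j : ℝ) + 1) / (N ^ m₀ : ℕ)))).toReal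
  have hstep : ∀ p, increments F (N ^ (m₀ + (p + 1))) ≤
      1 / 2 * increments F (N ^ (m₀ + p)) + (D + C) := by
    intro p
    have hpos : 0 < N ^ (m₀ + p) := pow_pos A.pos _
    rw [← add_assoc m₀, pow_succ', ← add_assoc]
    refine (hC _ hpos).trans (add_le_add ?_ le_rfl)
    have hpow : N ^ (m₀ + p) = N ^ m₀ * N ^ p := pow_add _ _ _
    have hMp : (0 : ℝ) < (N ^ p : ℕ) := by exact_mod_cast pow_pos A.pos p
    have hM0 : (0 : ℝ) < (N ^ m₀ : ℕ) := by exact_mod_cast pow_pos A.pos m₀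
    rw [increments, Finset.mul_sum]
    generalize hMdef : N ^ (m₀ + p) = M at *
    subst hpow
    rw [sum_range_mul_eq, sum_range_mul_eq, ← Finset.sum_add_distrib]
    refine Finset.sum_le_sum fun j hj => ?_
    have hj := Finset.mem_range.1 hj
    have hmem : ∀ b ≤ N ^ p, ((j * N ^ p + b : ℕ) : ℝ) / (N ^ m₀ * N ^ p : ℕ) ∈
        Icc ((j : ℝ) / (N ^ m₀ : ℕ)) (((j : ℝ) + 1) / (N ^ m₀ : ℕ)) := by
      intro b hb
      have hb' : (b : ℝ) ≤ (N ^ p : ℕ) := by exact_mod_cast hb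
      have e : ((j * N ^ p + b : ℕ) : ℝ) / (N ^ m₀ * N ^ p : ℕ) =
          ((j : ℝ) + b / (N ^ p : ℕ)) / (N ^ m₀ : ℕ) := by
        rw [Nat.cast_add, Nat.cast_mul, Nat.cast_mul]; field_simp
      rw [e]
      constructor
      · gcongr; exact le_add_of_nonneg_right (by positivity)
      · gcongr; exact div_le_one_of_le₀ hb' hMp.le
    have hvar0 : 0 ≤ G * (eVariationOn F
      (Icc ((j : ℝ) / (N ^ m₀ : ℕ)) (((j : ℝ) + 1) / (N ^ m₀ : ℕ)))).toReal :=
      mul_nonneg hG0 ENNReal.toReal_nonneg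
    rcases hcell j hj with hsmall | hbv
    · refine le_trans (Finset.sum_le_sum fun b hb => ?_) (le_add_of_nonneg_right hvar0)
      gcongr
      exact hsmall _ (hmem b (Finset.mem_range.1 hb).le)
    · refine le_trans ?_ (le_add_of_nonneg_left (Finset.sum_nonneg fun b _ => by positivity))
      have h1 := hbv.sum_abs_sub_le (n := N ^ p)
        (u := fun b : ℕ => ((j * N ^ p + b : ℕ) : ℝ) / (N ^ m₀ * N ^ p : ℕ))
        (fun a b hab => by simp only; gcongr) hmem
      refine le_trans ?_ (mul_le_mul_of_nonneg_left h1 hG0)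
      rw [Finset.mul_sum]
      refine Finset.sum_le_sum fun b hb => ?_
      have e : ((j * N ^ p + (b + 1) : ℕ) : ℝ) = ((j * N ^ p + b : ℕ) : ℝ) + 1 := by
        push_cast; ring
      rw [e]
      gcongr
      refine (le_abs_self _).trans (hG _ ?_)
      refine natCast_div_mem hpos ?_
      have : b < N ^ p := Finset.mem_range.1 hb
      calc j * N ^ p + b ≤ j * N ^ p + N ^ p := by omega
        _ = (j + 1) * N ^ p := by ring
        _ ≤ _ := Nat.mul_le_mul_right _ hj
  -- The set of values below `a + 2 |D + C|`, with `a ≥ 0`, is preserved by `x ↦ x / 2 + (D + C)`.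
  have hbound : ∀ p, increments F (N ^ (m₀ + p)) ≤ |increments F (N ^ m₀)| + 2 * |D + C| := by
    intro p
    induction p with
    | zero => rw [add_zero]; linarith [le_abs_self (increments F (N ^ m₀)), abs_nonneg (D + C)]
    | succ p ih =>
      have := hstep p
      linarith [le_abs_self (D + C), abs_nonneg (increments F (N ^ m₀)), abs_nonneg (D + C)]
  have hlim : Tendsto (fun p => increments F (N ^ (m₀ + p))) atTop atTop := by
    refine (tendsto_sum_increments_unit A.continuousOn_F htop).comp ?_
    refine (tendsto_pow_atTop_atTop_of_one_lt (by omega)).comp ?_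
    exact tendsto_atTop_mono (fun p => Nat.le_add_left p m₀) tendsto_id
  obtain ⟨p, hp⟩ := (hlim.eventually_gt_atTop
    (|increments F (N ^ m₀)| + 2 * |D + C|)).exists
  exact absurd (hbound p) (not_le.2 hp)

/-- If there were only `K` singular points, the coefficients of the `n`-th iterate would have
absolute sum at most `K s ^ n < 1/2` at each of them, and the variation would be finite. -/
lemma singularSet_infinite (A : SelfAffine F N) (hN : 2 ≤ N) {s : ℝ} (hs1 : s < 1)
    (hs : ∀ i < N, ∀ t ∈ Icc (0 : ℝ) 1, |A.S i t| ≤ s) (h : eVariationOn F (Icc 0 1) = ⊤) :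
    (singularSet F).Infinite := by
  intro hK
  have hs0 : 0 ≤ s := (abs_nonneg _).trans (hs 0 A.pos 0 (by simp))
  have hlim : Tendsto (fun n : ℕ => (hK.toFinset.card : ℝ) * s ^ n) atTop (𝓝 0) := by
    simpa using (tendsto_pow_atTop_nhds_zero_of_lt_one hs0 hs1).const_mul (hK.toFinset.card : ℝ)
  obtain ⟨n, hn, hn0⟩ := ((hlim.eventually (gt_mem_nhds (by norm_num : (0 : ℝ) < 1 / 2))).and
    (eventually_gt_atTop 0)).exists
  obtain ⟨B, hB, -⟩ := A.exists_iterate hs n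
  refine B.eVariationOn_ne_top_of_sum_lt (hN.trans (Nat.le_self_pow hn0.ne' N))
    (fun x hx => (B.sum_abs_S_le hB hK hx).trans_lt hn) h

lemma eVariationOn_cell_eq_top (A : SelfAffine F N) (hN : 2 ≤ N) {s : ℝ} (hs1 : s < 1)
    (hs : ∀ i < N, ∀ t ∈ Icc (0 : ℝ) 1, |A.S i t| ≤ s)
    (hz : ∀ i < N, {t ∈ Icc (0 : ℝ) 1 | A.S i t = 0}.Finite)
    (h : eVariationOn F (Icc 0 1) = ⊤) (k : ℕ) {j : ℕ} (hj : j < N ^ k) :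
    eVariationOn F (Icc ((j : ℝ) / (N : ℝ) ^ k) (((j : ℝ) + 1) / (N : ℝ) ^ k)) = ⊤ := by
  obtain ⟨B, -, hBz⟩ := A.exists_iterate hs k
  -- Cell `j` is the image of the `j`-th branch of the `k`-th iterate; an infinite set minus
  -- finitely many zeros leaves a singular point where that branch is nondegenerate.
  obtain ⟨x, hx, hxz⟩ := ((A.singularSet_infinite hN hs1 hs h).sdiff (hBz hz j hj)).nonempty
  have := B.eVariationOn_child_eq_top hj hx fun h0 => hxz ⟨hx.1, h0⟩
  simpa using this

end SelfAffine

/-! ### Oscillations -/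

section Oscillation

open Set

/-- The `c`-th of the `M` equal parts of `[0, 1]`. -/
def part (M c : ℕ) : Set ℝ := Icc ((c : ℝ) / M) (((c : ℝ) + 1) / M)

/-- The oscillation of `g` on the `c`-th of the `M` equal parts of `[0, 1]`. -/
noncomputable def osc (g : ℝ → ℝ) (M c : ℕ) : ℝ := Metric.diam (g '' part M c)

/-- The sum of the oscillations of `g` on the `M` equal parts of `[0, 1]`. -/
noncomputable def oscSum (g : ℝ → ℝ) (M : ℕ) : ℝ := ∑ c ∈ Finset.range M, osc g M c

lemma part_subset {M c : ℕ} (hc : c < M) : part M c ⊆ Icc 0 1 := by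
  have hM : 0 < M := by omega
  refine Icc_subset_Icc (by positivity) ?_
  exact_mod_cast (SelfAffine.natCast_div_mem hM (c := c + 1) hc).2

lemma osc_nonneg (g : ℝ → ℝ) (M c : ℕ) : 0 ≤ osc g M c := Metric.diam_nonneg

lemma oscSum_nonneg (g : ℝ → ℝ) (M : ℕ) : 0 ≤ oscSum g M :=
  Finset.sum_nonneg fun _ _ => osc_nonneg _ _ _

lemma abs_sub_le_osc {g : ℝ → ℝ} {B : ℝ} (hB : ∀ t ∈ Icc (0 : ℝ) 1, |g t| ≤ B) {M c : ℕ}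
    (hc : c < M) {u v : ℝ} (hu : u ∈ part M c) (hv : v ∈ part M c) : |g u - g v| ≤ osc g M c := by
  rw [← Real.dist_eq]
  refine Metric.dist_le_diam_of_mem ?_ (mem_image_of_mem g hu) (mem_image_of_mem g hv)
  refine (Metric.isBounded_Icc (-B) B).subset ?_
  rintro _ ⟨t, ht, rfl⟩
  exact abs_le.1 (hB t (part_subset hc ht))

lemma osc_le {g : ℝ → ℝ} {M c : ℕ} {C : ℝ} (hC : 0 ≤ C)
    (h : ∀ u ∈ part M c, ∀ v ∈ part M c, |g u - g v| ≤ C) : osc g M c ≤ C := by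
  refine Metric.diam_le_of_forall_dist_le hC ?_
  rintro _ ⟨u, hu, rfl⟩ _ ⟨v, hv, rfl⟩
  exact h u hu v hv

lemma oscSum_le_variation {g : ℝ → ℝ} (hg : BoundedVariationOn g (Icc 0 1)) {M : ℕ}
    (hM : 0 < M) : oscSum g M ≤ (eVariationOn g (Icc 0 1)).toReal := by
  have hM0 : (0 : ℝ) < M := by exact_mod_cast hM
  have hbv : ∀ c < M, BoundedVariationOn g (part M c) := fun c hc => hg.mono (part_subset hc)
  have h1 : ∀ c < M, osc g M c ≤ (eVariationOn g (part M c)).toReal := fun c hc =>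
    osc_le ENNReal.toReal_nonneg fun u hu v hv => (hbv c hc).dist_le hu hv
  have h2 := eVariationOn.sum' g (SelfAffine.natCast_div_mono M) (n := M)
  simp only [Nat.cast_zero, zero_div, div_self hM0.ne'] at h2
  rw [← h2, ENNReal.toReal_sum fun c hc => by
    simpa [part, BoundedVariationOn] using hbv c (Finset.mem_range.1 hc)]
  refine Finset.sum_le_sum fun c hc => ?_
  simpa [part] using h1 c (Finset.mem_range.1 hc)

end Oscillation

/-! ### Oscillations under the functional equation. -/

namespace SelfAffine

open Set

variable {F : ℝ → ℝ} {N : ℕ}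

lemma exists_preimage_part {i M c : ℕ} (hN : 0 < N) (hM : 0 < M) {t : ℝ}
    (ht : t ∈ part (N * M) (i * M + c)) : ∃ u ∈ part M c, t = ((i : ℝ) + u) / N := by
  have hN0 : (0 : ℝ) < N := by exact_mod_cast hN
  have hM0 : (0 : ℝ) < M := by exact_mod_cast hM
  obtain ⟨h1, h2⟩ := ht
  push_cast at h1 h2
  rw [div_le_iff₀ (by positivity)] at h1
  rw [le_div_iff₀ (by positivity)] at h2
  refine ⟨N * t - i, ⟨?_, ?_⟩, by field_simp; ring⟩
  · rw [div_le_iff₀ hM0]; nlinarith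
  · rw [le_div_iff₀ hM0]; nlinarith

lemma child_mem_part {i M c : ℕ} (hN : 0 < N) (hM : 0 < M) {u : ℝ} (hu : u ∈ part M c) :
    ((i : ℝ) + u) / N ∈ part (N * M) (i * M + c) := by
  have hN0 : (0 : ℝ) < N := by exact_mod_cast hN
  have hM0 : (0 : ℝ) < M := by exact_mod_cast hM
  obtain ⟨h1, h2⟩ := hu
  rw [div_le_iff₀ hM0] at h1
  rw [le_div_iff₀ hM0] at h2
  constructor
  · push_cast
    rw [div_le_div_iff₀ (by positivity) hN0]
    nlinarith
  · push_cast
    rw [div_le_div_iff₀ hN0 (by positivity)]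
    nlinarith

/-- The error term in the comparison of oscillations on a part and on its `i`-th copy. -/
noncomputable def err (A : SelfAffine F N) (B : ℝ) (M c : ℕ) : ℝ :=
  ∑ i ∈ Finset.range N, (B * osc (A.S i) M c + osc (A.q i) M c)

lemma err_nonneg (A : SelfAffine F N) {B : ℝ} (hB : 0 ≤ B) (M c : ℕ) : 0 ≤ A.err B M c :=
  Finset.sum_nonneg fun _ _ => add_nonneg (mul_nonneg hB (osc_nonneg _ _ _)) (osc_nonneg _ _ _)

lemma sum_err_le (A : SelfAffine F N) {B : ℝ} (hB : 0 ≤ B) : ∃ C, 0 ≤ C ∧ ∀ M, 0 < M →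
    ∑ c ∈ Finset.range M, A.err B M c ≤ C := by
  refine ⟨∑ i ∈ Finset.range N, (B * (eVariationOn (A.S i) (Icc 0 1)).toReal +
    (eVariationOn (A.q i) (Icc 0 1)).toReal), Finset.sum_nonneg fun i _ =>
    add_nonneg (mul_nonneg hB ENNReal.toReal_nonneg) ENNReal.toReal_nonneg, fun M hM => ?_⟩
  simp only [err]
  rw [Finset.sum_comm]
  refine Finset.sum_le_sum fun i hi => ?_
  have hi := Finset.mem_range.1 hi
  rw [Finset.sum_add_distrib, ← Finset.mul_sum]
  gcongr
  · exact oscSum_le_variation (A.bv_S i hi) hM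
  · exact oscSum_le_variation (A.bv_q i hi) hM

/-- The product rule for the increment. Since `err` sums over all branches, the bound depends on the
cell only and not on `i`. -/
lemma abs_increment_error_le (A : SelfAffine F N) {B : ℝ} (hB0 : 0 ≤ B)
    (hB : ∀ t ∈ Icc (0 : ℝ) 1, |F t| ≤ B) {i M c : ℕ} (hi : i < N) (hc : c < M) {u v : ℝ}
    (hu : u ∈ part M c) (hv : v ∈ part M c) :
    |F (((i : ℝ) + u) / N) - F (((i : ℝ) + v) / N) - A.S i u * (F u - F v)| ≤ A.err B M c := by
  obtain ⟨BS, -, hBS⟩ := (A.bv_S i hi).exists_abs_le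
  obtain ⟨Bq, -, hBq⟩ := (A.bv_q i hi).exists_abs_le
  have hsub := part_subset hc
  have e : F (((i : ℝ) + u) / N) - F (((i : ℝ) + v) / N) - A.S i u * (F u - F v) =
      F v * (A.S i u - A.S i v) + (A.q i u - A.q i v) := by
    rw [A.map_eq i hi u (hsub hu), A.map_eq i hi v (hsub hv)]; ring
  rw [e]
  refine (abs_add_le _ _).trans ?_
  rw [abs_mul]
  refine le_trans ?_ (Finset.single_le_sum
    (f := fun i => B * osc (A.S i) M c + osc (A.q i) M c) (fun _ _ =>
      add_nonneg (mul_nonneg hB0 (osc_nonneg _ _ _)) (osc_nonneg _ _ _)) (Finset.mem_range.2 hi))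
  gcongr
  · exact hB v (hsub hv)
  · exact abs_sub_le_osc hBS hc hu hv
  · exact abs_sub_le_osc hBq hc hu hv

lemma osc_child_le (A : SelfAffine F N) {B : ℝ} (hB0 : 0 ≤ B)
    (hB : ∀ t ∈ Icc (0 : ℝ) 1, |F t| ≤ B) {i M c : ℕ} (hi : i < N) (hc : c < M) {σ : ℝ}
    (hσ0 : 0 ≤ σ) (hσ : ∀ t ∈ part M c, |A.S i t| ≤ σ) :
    osc F (N * M) (i * M + c) ≤ σ * osc F M c + A.err B M c := by
  have hM : 0 < M := by omega
  refine osc_le (add_nonneg (mul_nonneg hσ0 (osc_nonneg _ _ _)) (A.err_nonneg hB0 _ _)) ?_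
  intro u' hu' v' hv'
  obtain ⟨u, hu, rfl⟩ := exists_preimage_part A.pos hM hu'
  obtain ⟨v, hv, rfl⟩ := exists_preimage_part A.pos hM hv'
  have h1 := A.abs_increment_error_le hB0 hB hi hc hu hv
  have h2 := abs_add_le (F (((i : ℝ) + u) / N) - F (((i : ℝ) + v) / N) - A.S i u * (F u - F v))
    (A.S i u * (F u - F v))
  rw [sub_add_cancel, abs_mul] at h2
  have h3 := mul_le_mul (hσ u hu) (abs_sub_le_osc hB hc hu hv) (abs_nonneg _) hσ0
  linarith

lemma le_osc_child (A : SelfAffine F N) {B : ℝ} (hB0 : 0 ≤ B)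
    (hB : ∀ t ∈ Icc (0 : ℝ) 1, |F t| ≤ B) {i M c : ℕ} (hi : i < N) (hc : c < M) {σ : ℝ}
    (hσ : ∀ t ∈ part M c, σ ≤ |A.S i t|) :
    σ * osc F M c - A.err B M c ≤ osc F (N * M) (i * M + c) := by
  have hM : 0 < M := by omega
  have hlt : i * M + c < N * M := by
    calc i * M + c < i * M + M := by omega
      _ = (i + 1) * M := by ring
      _ ≤ _ := Nat.mul_le_mul_right _ hi
  have hX := add_nonneg (osc_nonneg F (N * M) (i * M + c)) (A.err_nonneg hB0 M c)
  rw [sub_le_iff_le_add]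
  -- For `σ ≤ 0` the left side is nonpositive; otherwise dividing by `σ` reduces to bounding `osc F
  -- M c` pointwise.
  rcases le_or_gt σ 0 with h0 | h0
  · exact (mul_nonpos_of_nonpos_of_nonneg h0 (osc_nonneg _ _ _)).trans hX
  rw [← le_div_iff₀' h0]
  refine osc_le (div_nonneg hX h0.le) fun u hu v hv => ?_
  rw [le_div_iff₀' h0]
  have h1 := A.abs_increment_error_le hB0 hB hi hc hu hv
  have h2 := abs_sub_abs_le_abs_sub (A.S i u * (F u - F v))
    (F (((i : ℝ) + u) / N) - F (((i : ℝ) + v) / N))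
  rw [abs_sub_comm (A.S i u * (F u - F v)), abs_mul] at h2
  have h3 := abs_sub_le_osc hB hlt (child_mem_part A.pos hM hu) (child_mem_part A.pos hM hv)
  have h4 := mul_le_mul_of_nonneg_right (hσ u hu) (abs_nonneg (F u - F v))
  linarith

end SelfAffine

/-! ### The vectors of oscillations -/

section OscVec

open Set Matrix

/-- The sum of the oscillations of `F` over the parts of level `m + p` in the `r`-th part of
level `m`. -/
noncomputable def oscVec (F : ℝ → ℝ) (N m p : ℕ) (r : Fin (N ^ m)) : ℝ :=
  ∑ b ∈ Finset.range (N ^ p), osc F (N ^ (m + p)) (r * N ^ p + b)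

lemma oscVec_nonneg (F : ℝ → ℝ) (N m p : ℕ) (r : Fin (N ^ m)) : 0 ≤ oscVec F N m p r :=
  Finset.sum_nonneg fun _ _ => osc_nonneg _ _ _

lemma sum_oscVec (F : ℝ → ℝ) (N m p : ℕ) : ∑ r, oscVec F N m p r = oscSum F (N ^ (m + p)) := by
  have h1 : oscSum F (N ^ (m + p)) = ∑ c ∈ Finset.range (N ^ m * N ^ p), osc F (N ^ (m + p)) c := by
    rw [oscSum, ← pow_add]
  rw [h1, sum_range_mul_eq, ← Fin.sum_univ_eq_sum_range
    (fun r => ∑ b ∈ Finset.range (N ^ p), osc F (N ^ (m + p)) (r * N ^ p + b))]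
  rfl

variable {F : ℝ → ℝ} {N : ℕ}

/-- Cell `r` of level `k + 1` is the copy number `r / N ^ k` of cell `r % N ^ k` of level `k`, here
split into its `N` children. This reindexing makes the scaling matrix appear. -/
lemma oscVec_succ (k p : ℕ) (r : Fin (N ^ (k + 1))) :
    oscVec F N (k + 1) (p + 1) r = ∑ d : Fin N, ∑ b ∈ Finset.range (N ^ p),
      osc F (N * N ^ (k + 1 + p))
        (r / N ^ k * N ^ (k + 1 + p) + ((r % N ^ k * N + d) * N ^ p + b)) := by
  have h1 : oscVec F N (k + 1) (p + 1) r = ∑ b ∈ Finset.range (N * N ^ p),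
      osc F (N * N ^ (k + 1 + p)) (r * (N * N ^ p) + b) := by
    simp only [oscVec]
    rw [show k + 1 + (p + 1) = (k + 1 + p) + 1 by ring, pow_succ' N (k + 1 + p), pow_succ' N p]
  rw [h1, sum_range_mul_eq, ← Fin.sum_univ_eq_sum_range (fun d => ∑ b ∈ Finset.range (N ^ p),
    osc F (N * N ^ (k + 1 + p)) (r * (N * N ^ p) + (d * N ^ p + b)))]
  refine Finset.sum_congr rfl fun d _ => Finset.sum_congr rfl fun b _ => ?_
  congr 1
  have h2 := Nat.div_add_mod r.val (N ^ k)
  generalize r.val / N ^ k = i at *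
  generalize r.val % N ^ k = l at *
  rw [← h2, pow_add N (k + 1) p, pow_succ]
  ring

lemma subindex_lt {k p : ℕ} (hN : 0 < N) (r : ℕ) (d : Fin N) {b : ℕ} (hb : b < N ^ p) :
    (r % N ^ k * N + d) * N ^ p + b < N ^ (k + 1 + p) := by
  have h1 : r % N ^ k * N + d < N ^ (k + 1) := mul_add_lt_pow_succ (mod_pow_lt hN _) d.isLt
  rw [pow_add]
  calc (r % N ^ k * N + d) * N ^ p + b < (r % N ^ k * N + d) * N ^ p + N ^ p := by omega
    _ = (r % N ^ k * N + d + 1) * N ^ p := by ring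
    _ ≤ _ := Nat.mul_le_mul_right _ h1

lemma part_subset_part {M P c b : ℕ} (hM : 0 < M) (hb : b < P) :
    part (M * P) (c * P + b) ⊆ part M c := by
  have hM0 : (0 : ℝ) < M := by exact_mod_cast hM
  have hP0 : (0 : ℝ) < P := by exact_mod_cast (by omega : 0 < P)
  have hb' : (b : ℝ) + 1 ≤ P := by exact_mod_cast hb
  refine Icc_subset_Icc ?_ ?_
  · push_cast
    rw [div_le_div_iff₀ hM0 (by positivity)]
    have : (0 : ℝ) ≤ b * M := by positivity
    nlinarith
  · push_cast
    rw [div_le_div_iff₀ (by positivity) hM0]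
    nlinarith [mul_le_mul_of_nonneg_right hb' hM0.le]

/-- The subcells that feed one row have distinct indices, so the errors in a row are bounded by the
error over the whole level. -/
lemma sum_block_le {g : ℕ → ℝ} (hg : ∀ c, 0 ≤ g c) {k p : ℕ} (hN : 0 < N) (r : ℕ) :
    ∑ d : Fin N, ∑ b ∈ Finset.range (N ^ p), g ((r % N ^ k * N + d) * N ^ p + b) ≤
      ∑ c ∈ Finset.range (N ^ (k + 1 + p)), g c := by
  have e : N ^ (k + 1 + p) = N ^ k * (N * N ^ p) := by ring
  rw [e, sum_range_mul_eq]
  refine le_trans (le_of_eq ?_) (Finset.single_le_sum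
    (f := fun r => ∑ s ∈ Finset.range (N * N ^ p), g (r * (N * N ^ p) + s))
    (fun _ _ => Finset.sum_nonneg fun _ _ => hg _) (Finset.mem_range.2 (mod_pow_lt hN r)))
  rw [sum_range_mul_eq, ← Fin.sum_univ_eq_sum_range (fun d => ∑ b ∈ Finset.range (N ^ p),
    g (r % N ^ k * (N * N ^ p) + (d * N ^ p + b)))]
  refine Finset.sum_congr rfl fun d _ => Finset.sum_congr rfl fun b _ => ?_
  congr 1
  ring

lemma oscVec_succ_le (A : SelfAffine F N) (k : ℕ) {s : Fin N → Fin (N ^ (k + 1)) → ℝ}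
    (hs : ∀ (i : Fin N) (j : Fin (N ^ (k + 1))), ∀ t ∈ part (N ^ (k + 1)) j, |A.S i t| ≤ s i j) :
    ∃ C, ∀ p r, oscVec F N (k + 1) (p + 1) r ≤
      (scalingMatrix N k s *ᵥ oscVec F N (k + 1) p) r + C := by
  obtain ⟨B, hB0, hB⟩ := A.exists_abs_F_le
  obtain ⟨C, -, hC⟩ := A.sum_err_le hB0
  refine ⟨C, fun p r => ?_⟩
  have hi : r.val / N ^ k < N := Nat.div_lt_of_lt_mul (lt_of_lt_of_eq r.isLt (pow_succ N k))
  rw [oscVec_succ, scalingMatrix_mulVec A.pos]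
  refine le_trans ?_ (add_le_add le_rfl ((sum_block_le (A.err_nonneg hB0 (N ^ (k + 1 + p)))
    A.pos r.val (k := k) (p := p)).trans (hC _ (pow_pos A.pos _))))
  rw [← Finset.sum_add_distrib]
  refine Finset.sum_le_sum fun d _ => ?_
  simp only [oscVec]
  rw [Finset.mul_sum, ← Finset.sum_add_distrib]
  refine Finset.sum_le_sum fun b hb => ?_
  have hb := Finset.mem_range.1 hb
  have hlt : r.val % N ^ k * N + d < N ^ (k + 1) :=
    mul_add_lt_pow_succ (mod_pow_lt A.pos _) d.isLt
  have hsub : part (N ^ (k + 1 + p)) ((r.val % N ^ k * N + d) * N ^ p + b) ⊆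
      part (N ^ (k + 1)) (r.val % N ^ k * N + d) := by
    rw [pow_add]; exact part_subset_part (pow_pos A.pos _) hb
  have hbd := hs ⟨r.val / N ^ k, hi⟩ ⟨_, hlt⟩
  refine A.osc_child_le hB0 hB hi (subindex_lt A.pos _ d hb) ?_ fun t ht => hbd t (hsub ht)
  exact (abs_nonneg _).trans (hbd _ (left_mem_Icc.2 (by gcongr; linarith)))

lemma le_oscVec_succ (A : SelfAffine F N) (k : ℕ) {s : Fin N → Fin (N ^ (k + 1)) → ℝ}
    (hs : ∀ (i : Fin N) (j : Fin (N ^ (k + 1))), ∀ t ∈ part (N ^ (k + 1)) j, s i j ≤ |A.S i t|) :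
    ∃ C, 0 ≤ C ∧ ∀ p r, (scalingMatrix N k s *ᵥ oscVec F N (k + 1) p) r - C ≤
      oscVec F N (k + 1) (p + 1) r := by
  obtain ⟨B, hB0, hB⟩ := A.exists_abs_F_le
  obtain ⟨C, hC0, hC⟩ := A.sum_err_le hB0
  refine ⟨C, hC0, fun p r => ?_⟩
  have hi : r.val / N ^ k < N := Nat.div_lt_of_lt_mul (lt_of_lt_of_eq r.isLt (pow_succ N k))
  rw [oscVec_succ, scalingMatrix_mulVec A.pos]
  refine (sub_le_sub_left ((sum_block_le (A.err_nonneg hB0 (N ^ (k + 1 + p)))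
    A.pos r.val (k := k) (p := p)).trans (hC _ (pow_pos A.pos _))) _).trans ?_
  rw [← Finset.sum_sub_distrib]
  refine Finset.sum_le_sum fun d _ => ?_
  simp only [oscVec]
  rw [Finset.mul_sum, ← Finset.sum_sub_distrib]
  refine Finset.sum_le_sum fun b hb => ?_
  have hb := Finset.mem_range.1 hb
  have hlt : r.val % N ^ k * N + d < N ^ (k + 1) :=
    mul_add_lt_pow_succ (mod_pow_lt A.pos _) d.isLt
  have hsub : part (N ^ (k + 1 + p)) ((r.val % N ^ k * N + d) * N ^ p + b) ⊆
      part (N ^ (k + 1)) (r.val % N ^ k * N + d) := by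
    rw [pow_add]; exact part_subset_part (pow_pos A.pos _) hb
  exact A.le_osc_child hB0 hB hi (subindex_lt A.pos _ d hb) fun t ht =>
    hs ⟨r.val / N ^ k, hi⟩ ⟨_, hlt⟩ t (hsub ht)

/-- Oscillations dominate increments over the same grid, and those diverge when the variation on the
cell is infinite. -/
lemma tendsto_oscVec (hF : ContinuousOn F (Icc 0 1)) (hN : 2 ≤ N) {m : ℕ} (r : Fin (N ^ m))
    (h : eVariationOn F (part (N ^ m) r) = ⊤) :
    Tendsto (fun p => oscVec F N m p r) atTop atTop := by
  obtain ⟨B, hB⟩ := isCompact_Icc.exists_bound_of_continuousOn hF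
  have hM : 0 < N ^ m := pow_pos (by omega) m
  have hM0 : (0 : ℝ) < (N ^ m : ℕ) := by exact_mod_cast hM
  have h1 := tendsto_sum_increments (by gcongr; linarith) (hF.mono (part_subset r.isLt)) h
  refine tendsto_atTop_mono (fun p => ?_)
    (h1.comp (tendsto_pow_atTop_atTop_of_one_lt (by omega : 1 < N)))
  simp only [Function.comp]
  refine Finset.sum_le_sum fun b hb => ?_
  have hb := Finset.mem_range.1 hb
  have hP0 : (0 : ℝ) < (N ^ p : ℕ) := by exact_mod_cast pow_pos (by omega : 0 < N) p
  have e : ∀ x : ℝ, (r : ℝ) / (N ^ m : ℕ) + x / (N ^ p : ℕ) *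
      (((r : ℝ) + 1) / (N ^ m : ℕ) - (r : ℝ) / (N ^ m : ℕ)) =
      (((r * N ^ p : ℕ) : ℝ) + x) / (N ^ (m + p) : ℕ) := fun x => by
    rw [pow_add, Nat.cast_mul, Nat.cast_mul]; field_simp; ring
  have hlt : r * N ^ p + b < N ^ (m + p) := by
    rw [pow_add]
    calc r * N ^ p + b < r * N ^ p + N ^ p := by omega
      _ = (r + 1) * N ^ p := by ring
      _ ≤ _ := Nat.mul_le_mul_right _ r.isLt
  rw [e, e]
  refine abs_sub_le_osc hB hlt ?_ ?_
  · constructor <;> refine div_le_div_of_nonneg_right ?_ (by positivity) <;> push_cast <;> linarith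
  · constructor <;> refine div_le_div_of_nonneg_right ?_ (by positivity) <;> push_cast <;> linarith

end OscVec

/-! ### Counting squares that meet a graph -/

section BoxCount

open Set

/-- The graph of a function on `[0, 1]`, with the base rescaled to `[x₀, x₀ + D]`. -/
def scaledGraph (x₀ D : ℝ) (F : ℝ → ℝ) : Set (ℝ × ℝ) := (fun t => (x₀ + D * t, F t)) '' Icc 0 1

lemma exists_mem_part {M : ℕ} (hM : 0 < M) {t : ℝ} (ht : t ∈ Icc (0 : ℝ) 1) :
    ∃ c < M, t ∈ part M c := by
  have hM0 : (0 : ℝ) < M := by exact_mod_cast hM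
  rcases ht.2.lt_or_eq with h1 | rfl
  · have h0 : 0 ≤ t * M := mul_nonneg ht.1 hM0.le
    refine ⟨⌊t * M⌋₊, ?_, ?_, ?_⟩
    · rw [Nat.floor_lt h0]
      exact mul_lt_of_lt_one_left hM0 h1
    · rw [div_le_iff₀ hM0]; exact Nat.floor_le h0
    · rw [le_div_iff₀ hM0]; exact (Nat.lt_floor_add_one _).le
  · refine ⟨M - 1, by omega, ?_, ?_⟩
    · exact (SelfAffine.natCast_div_mem hM (Nat.sub_le M 1)).2
    · rw [Nat.cast_pred hM, sub_add_cancel, div_self hM0.ne']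

/-- The hypothesis `a ≤ b + 1` keeps the right side nonnegative when the interval contains no
integer. -/
lemma card_Icc_int_le {a b : ℝ} (hab : a ≤ b + 1) : ((Finset.Icc ⌈a⌉ ⌊b⌋).card : ℝ) ≤ b - a + 1 := by
  rw [Int.card_Icc]
  have h1 := Int.floor_le b
  have h2 := Int.le_ceil a
  rcases le_or_gt (⌊b⌋ + 1 - ⌈a⌉) 0 with h | h
  · rw [Int.toNat_of_nonpos h]; simp only [Nat.cast_zero]; linarith
  · have h3 : (((⌊b⌋ + 1 - ⌈a⌉).toNat : ℤ) : ℝ) = ((⌊b⌋ + 1 - ⌈a⌉ : ℤ) : ℝ) := by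
      rw [Int.toNat_of_nonneg h.le]
    rw [Int.cast_natCast] at h3
    rw [h3]
    push_cast
    linarith

variable {F : ℝ → ℝ} {x₀ D B : ℝ}

/-- Over a part of width at most `ε` the squares lie in at most `3` columns and `2 osc / ε + 2`
rows. Finiteness is recorded because `ncard` of an infinite set is `0`. -/
lemma boxCount_upper_aux (hB : ∀ t ∈ Icc (0 : ℝ) 1, |F t| ≤ B) (hD : 0 < D) {M : ℕ}
    (hM : 0 < M) {ε : ℝ} (hε : 0 < ε) (hMε : D / M ≤ ε) :
    {k : ℤ × ℤ | (coordSquare ε k ∩ scaledGraph x₀ D F).Nonempty}.Finite ∧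
      (boxCount (scaledGraph x₀ D F) ε : ℝ) ≤ 6 * (oscSum F M / ε) + 6 * M := by
  classical
  have hM0 : (0 : ℝ) < M := by exact_mod_cast hM
  let T : ℕ → Finset (ℤ × ℤ) := fun c =>
    Finset.Icc (⌊(x₀ + D * (c / M)) / ε⌋ - 1) (⌊(x₀ + D * (c / M)) / ε⌋ + 1) ×ˢ
      Finset.Icc ⌈(F (c / M) - osc F M c) / ε - 1⌉ ⌊(F (c / M) + osc F M c) / ε⌋
  have hsub : {k : ℤ × ℤ | (coordSquare ε k ∩ scaledGraph x₀ D F).Nonempty} ⊆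
      ((Finset.range M).biUnion T : Finset (ℤ × ℤ)) := by
    rintro ⟨k₁, k₂⟩ ⟨_, ⟨⟨hx1, hx2⟩, hy1, hy2⟩, t, ht, rfl⟩
    simp only at hx1 hx2 hy1 hy2
    obtain ⟨c, hc, htc⟩ := exists_mem_part hM ht
    refine Finset.mem_coe.2 (Finset.mem_biUnion.2 ⟨c, Finset.mem_range.2 hc, ?_⟩)
    have hc0 : (c : ℝ) / M ∈ part M c := left_mem_Icc.2 (by gcongr; linarith)
    have hosc := abs_le.1 (abs_sub_le_osc hB hc htc hc0)
    have ht1 : D * (c / M) ≤ D * t := mul_le_mul_of_nonneg_left htc.1 hD.le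
    have ht2 : D * t ≤ D * (c / M) + ε := by
      have := mul_le_mul_of_nonneg_left htc.2 hD.le
      have e : D * (((c : ℝ) + 1) / M) = D * (c / M) + D / M := by field_simp
      linarith
    simp only [T, Finset.mem_product, Finset.mem_Icc]
    refine ⟨⟨?_, ?_⟩, ?_, ?_⟩
    · have h1 : (x₀ + D * (c / M)) / ε ≤ k₁ + 1 := by
        rw [div_le_iff₀ hε]; linarith
      have h2 : (⌊(x₀ + D * (c / M)) / ε⌋ : ℝ) ≤ ((k₁ + 1 : ℤ) : ℝ) := by
        push_cast; exact (Int.floor_le _).trans h1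
      have := Int.cast_le.1 h2
      omega
    · have h1 : ((k₁ - 1 : ℤ) : ℝ) ≤ (x₀ + D * (c / M)) / ε := by
        rw [le_div_iff₀ hε]; push_cast; linarith
      have := Int.le_floor.2 h1
      omega
    · rw [Int.ceil_le, sub_le_iff_le_add, div_le_iff₀ hε]; linarith [hosc.1]
    · rw [Int.le_floor, le_div_iff₀ hε]; linarith [hosc.2]
  refine ⟨(Finset.finite_toSet _).subset hsub, ?_⟩
  have h1 : boxCount (scaledGraph x₀ D F) ε ≤ ((Finset.range M).biUnion T).card := by
    rw [boxCount, ← Set.ncard_coe_finset]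
    exact Set.ncard_le_ncard hsub (Finset.finite_toSet _)
  have h2 : ∀ c, ((T c).card : ℝ) ≤ 6 * (osc F M c / ε) + 6 := fun c => by
    have ho := osc_nonneg F M c
    have h3 : ((Finset.Icc (⌊(x₀ + D * (c / M)) / ε⌋ - 1)
        (⌊(x₀ + D * (c / M)) / ε⌋ + 1)).card : ℝ) = 3 := by
      rw [Int.card_Icc, show ∀ z : ℤ, z + 1 + 1 - (z - 1) = 3 by intro z; ring]
      exact_mod_cast (rfl : Int.toNat 3 = 3)
    have h4 := card_Icc_int_le (a := (F (c / M) - osc F M c) / ε - 1)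
      (b := (F (c / M) + osc F M c) / ε) (by
        have : (F (c / M) - osc F M c) / ε ≤ (F (c / M) + osc F M c) / ε := by
          gcongr; linarith
        linarith)
    simp only [T, Finset.card_product, Nat.cast_mul]
    rw [h3]
    refine (mul_le_mul_of_nonneg_left h4 (by norm_num)).trans (le_of_eq ?_)
    field_simp
    ring
  calc (boxCount (scaledGraph x₀ D F) ε : ℝ) ≤ (((Finset.range M).biUnion T).card : ℝ) := by
        exact_mod_cast h1
    _ ≤ ((∑ c ∈ Finset.range M, (T c).card : ℕ) : ℝ) := by
        exact_mod_cast Finset.card_biUnion_le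
    _ ≤ ∑ c ∈ Finset.range M, (6 * (osc F M c / ε) + 6) := by
        push_cast; exact Finset.sum_le_sum fun c _ => h2 c
    _ = _ := by
        rw [Finset.sum_add_distrib, ← Finset.mul_sum, ← Finset.sum_div]
        simp [oscSum, mul_comm]

lemma finite_squares (hF : ContinuousOn F (Icc 0 1)) (hD : 0 < D) {ε : ℝ} (hε : 0 < ε) :
    {k : ℤ × ℤ | (coordSquare ε k ∩ scaledGraph x₀ D F).Nonempty}.Finite := by
  obtain ⟨B, hB⟩ := isCompact_Icc.exists_bound_of_continuousOn hF
  obtain ⟨M, hM⟩ := exists_nat_one_div_lt (div_pos hε hD)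
  refine (boxCount_upper_aux hB hD (Nat.succ_pos M) hε ?_).1
  rw [lt_div_iff₀ hD] at hM
  push_cast
  refine le_trans (le_of_eq ?_) hM.le
  ring

lemma boxCount_le (hF : ContinuousOn F (Icc 0 1)) (hD : 0 < D) {M : ℕ}
    (hM : 0 < M) {ε : ℝ} (hε : 0 < ε) (hMε : D / M ≤ ε) :
    (boxCount (scaledGraph x₀ D F) ε : ℝ) ≤ 6 * (oscSum F M / ε) + 6 * M := by
  obtain ⟨B, hB⟩ := isCompact_Icc.exists_bound_of_continuousOn hF
  exact (boxCount_upper_aux hB hD hM hε hMε).2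

lemma card_parts_le_three (hD : 0 < D) {M : ℕ} (hM : 0 < M) {ε : ℝ}
    (hMε : ε ≤ D / M) (k : ℤ) {P : ℕ → Prop} [DecidablePred P]
    (hP : ∀ c, P c → ∃ t ∈ part M c, k * ε ≤ x₀ + D * t ∧ x₀ + D * t ≤ (k + 1) * ε) :
    ((Finset.range M).filter P).card ≤ 3 := by
  have hM0 : (0 : ℝ) < M := by exact_mod_cast hM
  -- The right edge of the column, measured in parts. A part that meets the column has `β - 2 ≤ c ≤
  -- β`, as the column is no wider than a part; such a range holds at most three integers.
  let β : ℝ := ((k + 1) * ε - x₀) / (D / M)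
  have h1 : ((Finset.range M).filter P).card ≤ (Finset.Icc ⌈β - 2⌉ ⌊β⌋).card := by
    refine Finset.card_le_card_of_injOn (fun c : ℕ => (c : ℤ)) ?_ fun a _ b _ h => by
      simpa using h
    intro c hc
    obtain ⟨t, ht, h1, h2⟩ := hP c (Finset.mem_filter.1 (Finset.mem_coe.1 hc)).2
    have hDM : 0 < D / M := by positivity
    have e0 : D / M * c = D * (c / M) := by ring
    have e1 : D / M * (c + 1) = D * ((c + 1) / M) := by ring
    have h3 := mul_le_mul_of_nonneg_left ht.1 hD.le
    have h4 := mul_le_mul_of_nonneg_left ht.2 hD.le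
    rw [Finset.mem_coe, Finset.mem_Icc, Int.ceil_le, Int.le_floor]
    simp only [Int.cast_natCast, β]
    constructor
    · rw [sub_le_iff_le_add, div_le_iff₀ hDM]
      linarith
    · rw [le_div_iff₀ hDM]
      linarith
  refine h1.trans ?_
  rw [Int.card_Icc]
  have h2 : ⌈β - 2⌉ = ⌈β⌉ - 2 := by exact_mod_cast Int.ceil_sub_intCast β 2
  have h3 := Int.floor_le_ceil β
  omega

/-- By the intermediate value theorem the graph over the part meets every row between the minimum
and the maximum of `F`. -/
lemma le_card_squares (hF : ContinuousOn F (Icc 0 1)) {M c : ℕ} (hc : c < M) {ε : ℝ}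
    (hε : 0 < ε) {S : Finset (ℤ × ℤ)}
    (hS : ∀ t ∈ part M c, ∀ k : ℤ × ℤ, (x₀ + D * t, F t) ∈ coordSquare ε k → k ∈ S) :
    max 1 (osc F M c / ε) ≤ S.card := by
  have hM0 : (0 : ℝ) < M := by exact_mod_cast (by omega : 0 < M)
  have hcont : ContinuousOn F (part M c) := hF.mono (part_subset hc)
  have hne : (part M c).Nonempty := nonempty_Icc.2 (by gcongr; linarith)
  obtain ⟨a, ha, hamin⟩ := isCompact_Icc.exists_isMinOn hne hcont
  obtain ⟨b, hb, hbmax⟩ := isCompact_Icc.exists_isMaxOn hne hcont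
  have hab : F a ≤ F b := hamin hb
  have hosc : osc F M c ≤ F b - F a := osc_le (sub_nonneg.2 hab) fun u hu v hv => by
    have h1 := isMinOn_iff.1 hamin
    have h2 := isMaxOn_iff.1 hbmax
    rw [abs_le]
    constructor <;> linarith [h1 u hu, h1 v hv, h2 u hu, h2 v hv]
  have hsub : Icc (F a) (F b) ⊆ F '' part M c :=
    (isPreconnected_Icc.image F hcont).Icc_subset (mem_image_of_mem F ha) (mem_image_of_mem F hb)
  have hex : ∀ k ∈ Finset.Icc ⌊F a / ε⌋ ⌊F b / ε⌋, ∃ k₁ : ℤ, (k₁, k) ∈ S := by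
    intro k hk
    rw [Finset.mem_Icc, Int.le_floor, le_div_iff₀ hε] at hk
    -- The maximum is needed in the lowest row, whose bottom edge may lie below the least value `F
    -- a`.
    obtain ⟨t, ht, hty⟩ := hsub (show max (F a) (k * ε) ∈ Icc (F a) (F b) from
      ⟨le_max_left _ _, max_le hab hk.2⟩)
    refine ⟨⌊(x₀ + D * t) / ε⌋, hS t ht _ ⟨⟨?_, ?_⟩, ?_, ?_⟩⟩
    · simp only; rw [← le_div_iff₀ hε]; exact Int.floor_le _
    · simp only; rw [← div_le_iff₀ hε]; exact (Int.lt_floor_add_one _).le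
    · simp only; rw [hty]; exact le_max_right _ _
    · simp only; rw [hty]
      refine max_le ?_ (by nlinarith)
      rw [← div_le_iff₀ hε]
      refine (Int.lt_floor_add_one _).le.trans ?_
      have : (⌊F a / ε⌋ : ℝ) ≤ k := by exact_mod_cast hk.1
      linarith
  choose! κ hκ using hex
  have hcard : (Finset.Icc ⌊F a / ε⌋ ⌊F b / ε⌋).card ≤ S.card :=
    Finset.card_le_card_of_injOn (fun k => (κ k, k)) (fun k hk => hκ k hk)
      fun x _ y _ h => congrArg Prod.snd h
  have hfl : ⌊F a / ε⌋ ≤ ⌊F b / ε⌋ := Int.floor_le_floor (by gcongr)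
  have hcast : ((Finset.Icc ⌊F a / ε⌋ ⌊F b / ε⌋).card : ℝ) = ⌊F b / ε⌋ + 1 - ⌊F a / ε⌋ := by
    rw [Int.card_Icc]
    have h3 : (((⌊F b / ε⌋ + 1 - ⌊F a / ε⌋).toNat : ℤ) : ℝ) =
        ((⌊F b / ε⌋ + 1 - ⌊F a / ε⌋ : ℤ) : ℝ) := by
      rw [Int.toNat_of_nonneg (by omega)]
    rw [Int.cast_natCast] at h3
    rw [h3]
    push_cast
    ring
  have hcard' : ((Finset.Icc ⌊F a / ε⌋ ⌊F b / ε⌋).card : ℝ) ≤ S.card := by exact_mod_cast hcard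
  rw [hcast] at hcard'
  refine le_trans (max_le ?_ ?_) hcard'
  · have : (⌊F a / ε⌋ : ℝ) ≤ ⌊F b / ε⌋ := by exact_mod_cast hfl
    linarith
  · have h1 : osc F M c / ε ≤ F b / ε - F a / ε := by
      rw [← sub_div]; gcongr
    linarith [Int.lt_floor_add_one (F b / ε), Int.floor_le (F a / ε)]

/-- Double counting of incident parts and squares: a square meets at most three parts. The `max`
gives the bounds by `M` and by the oscillation sum together. -/
lemma sum_max_le_boxCount (hF : ContinuousOn F (Icc 0 1)) (hD : 0 < D) {M : ℕ}
    (hM : 0 < M) {ε : ℝ} (hε : 0 < ε) (hMε : ε ≤ D / M) :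
    ∑ c ∈ Finset.range M, max 1 (osc F M c / ε) ≤ 3 * (boxCount (scaledGraph x₀ D F) ε : ℝ) := by
  classical
  have hfin := finite_squares (x₀ := x₀) hF hD hε
  let P : ℕ → ℤ × ℤ → Prop := fun c k => ∃ t ∈ part M c, (x₀ + D * t, F t) ∈ coordSquare ε k
  have h1 : ∀ c ∈ Finset.range M,
      max 1 (osc F M c / ε) ≤ ((hfin.toFinset.filter (P c)).card : ℝ) := fun c hc => by
    have hc := Finset.mem_range.1 hc
    refine le_card_squares (x₀ := x₀) (D := D) hF hc hε fun t ht k hk => ?_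
    rw [Finset.mem_filter, Set.Finite.mem_toFinset]
    exact ⟨⟨_, hk, t, part_subset hc ht, rfl⟩, t, ht, hk⟩
  have h2 : ∑ c ∈ Finset.range M, (hfin.toFinset.filter (P c)).card ≤
      3 * boxCount (scaledGraph x₀ D F) ε := by
    simp only [Finset.card_filter]
    rw [Finset.sum_comm, boxCount, Set.ncard_eq_toFinset_card _ hfin]
    calc ∑ k ∈ hfin.toFinset, ∑ c ∈ Finset.range M, (if P c k then 1 else 0)
        ≤ ∑ _k ∈ hfin.toFinset, 3 := Finset.sum_le_sum fun k _ => by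
          rw [← Finset.card_filter]
          refine card_parts_le_three (x₀ := x₀) hD hM hMε k.1 ?_
          rintro c ⟨t, ht, hk⟩
          exact ⟨t, ht, hk.1.1, hk.1.2⟩
      _ = _ := by rw [Finset.sum_const, smul_eq_mul, mul_comm]
  refine (Finset.sum_le_sum h1).trans ?_
  exact_mod_cast h2

lemma natCast_le_boxCount (hF : ContinuousOn F (Icc 0 1)) (hD : 0 < D) {M : ℕ}
    (hM : 0 < M) {ε : ℝ} (hε : 0 < ε) (hMε : ε ≤ D / M) :
    (M : ℝ) ≤ 3 * (boxCount (scaledGraph x₀ D F) ε : ℝ) := by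
  refine le_trans ?_ (sum_max_le_boxCount hF hD hM hε hMε)
  calc (M : ℝ) = ∑ _c ∈ Finset.range M, (1 : ℝ) := by simp
    _ ≤ _ := Finset.sum_le_sum fun c _ => le_max_left _ _

lemma oscSum_div_le_boxCount (hF : ContinuousOn F (Icc 0 1)) (hD : 0 < D) {M : ℕ}
    (hM : 0 < M) {ε : ℝ} (hε : 0 < ε) (hMε : ε ≤ D / M) :
    oscSum F M / ε ≤ 3 * (boxCount (scaledGraph x₀ D F) ε : ℝ) := by
  refine le_trans ?_ (sum_max_le_boxCount hF hD hM hε hMε)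
  rw [oscSum, Finset.sum_div]
  exact Finset.sum_le_sum fun c _ => le_max_right _ _

end BoxCount

/-! ### Box dimensions from counts along powers of `N` -/

section Dimension

lemma tendsto_const_add_div_log (β K : ℝ) :
    Tendsto (fun ε : ℝ => ((β + K / Real.log (1 / ε) : ℝ) : EReal)) (𝓝[>] 0) (𝓝 (β : EReal)) := by
  have h1 : Tendsto (fun ε : ℝ => Real.log (1 / ε)) (𝓝[>] 0) atTop := by
    simp only [one_div]
    exact Real.tendsto_log_atTop.comp tendsto_inv_nhdsGT_zero
  have h2 : Tendsto (fun ε : ℝ => β + K / Real.log (1 / ε)) (𝓝[>] 0) (𝓝 (β + 0)) :=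
    tendsto_const_nhds.add (tendsto_const_nhds.div_atTop h1)
  rw [add_zero] at h2
  exact (continuous_coe_real_ereal.tendsto β).comp h2

lemma eventually_log_one_div_pos : ∀ᶠ ε : ℝ in 𝓝[>] 0, 0 < ε ∧ 0 < Real.log (1 / ε) := by
  filter_upwards [Ioo_mem_nhdsGT (zero_lt_one' ℝ)] with ε hε
  exact ⟨hε.1, Real.log_pos (one_lt_one_div hε.1 hε.2)⟩

lemma upperBoxDim_le_of_log_le {E : Set (ℝ × ℝ)} {β K : ℝ}
    (h : ∀ᶠ ε : ℝ in 𝓝[>] 0, Real.log (boxCount E ε) ≤ β * Real.log (1 / ε) + K) :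
    upperBoxDim E ≤ (β : EReal) := by
  rw [← (tendsto_const_add_div_log β K).limsup_eq]
  refine limsup_le_limsup ?_
  filter_upwards [h, eventually_log_one_div_pos] with ε h1 h2
  rw [EReal.coe_le_coe_iff, div_le_iff₀ h2.2, add_mul, div_mul_cancel₀ _ h2.2.ne']
  exact h1

lemma le_lowerBoxDim_of_le_log {E : Set (ℝ × ℝ)} {β K : ℝ}
    (h : ∀ᶠ ε : ℝ in 𝓝[>] 0, β * Real.log (1 / ε) + K ≤ Real.log (boxCount E ε)) :
    (β : EReal) ≤ lowerBoxDim E := by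
  rw [← (tendsto_const_add_div_log β K).liminf_eq]
  refine liminf_le_liminf ?_
  filter_upwards [h, eventually_log_one_div_pos] with ε h1 h2
  rw [EReal.coe_le_coe_iff, le_div_iff₀ h2.2, add_mul, div_mul_cancel₀ _ h2.2.ne']
  exact h1

lemma lowerBoxDim_le_upperBoxDim (E : Set (ℝ × ℝ)) : lowerBoxDim E ≤ upperBoxDim E :=
  liminf_le_limsup

variable {E : Set (ℝ × ℝ)} {N : ℕ} {D η C : ℝ}

/-- The exponent `m` with `N ^ m ≤ D / ε < N ^ (m + 1)` is `log (1 / ε) / log N` up to a bounded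
error, and bounded errors vanish after division by `log (1 / ε)`. -/
lemma upperBoxDim_le_of_boxCount_le (hN : 2 ≤ N) (hD : 0 < D) (hη : 1 ≤ η)
    (h : ∀ (m : ℕ) (ε : ℝ), 0 < ε → (N : ℝ) ^ m ≤ D / ε → D / ε < (N : ℝ) ^ (m + 1) →
      (boxCount E ε : ℝ) ≤ C * η ^ m) :
    upperBoxDim E ≤ ((Real.log η / Real.log N : ℝ) : EReal) := by
  have hN1 : (1 : ℝ) < N := by exact_mod_cast hN
  have hlN : 0 < Real.log N := Real.log_pos hN1
  have hlη : 0 ≤ Real.log η := Real.log_nonneg hη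
  refine upperBoxDim_le_of_log_le (K := Real.log η / Real.log N * Real.log D +
    Real.log (max C 1)) ?_
  filter_upwards [Ioo_mem_nhdsGT hD] with ε hε
  have hε0 : 0 < ε := hε.1
  obtain ⟨m, hm1, hm2⟩ := exists_nat_pow_near ((one_le_div hε.1).2 hε.2.le) hN1
  have hb : (boxCount E ε : ℝ) ≤ max C 1 * η ^ m :=
    (h m ε hε.1 hm1 hm2).trans (by gcongr; exact le_max_left _ _)
  have hmlog : m * Real.log N ≤ Real.log D + Real.log (1 / ε) := by
    have := Real.log_le_log (by positivity) hm1
    rwa [Real.log_pow, div_eq_mul_one_div, Real.log_mul hD.ne' (by positivity)] at this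
  have h1 : Real.log (boxCount E ε) ≤ Real.log (max C 1) + m * Real.log η := by
    -- An empty count has logarithm `0` by convention, and the right side is nonnegative.
    rcases Nat.eq_zero_or_pos (boxCount E ε) with h0 | h0
    · rw [h0, Nat.cast_zero, Real.log_zero]
      exact add_nonneg (Real.log_nonneg (le_max_right _ _)) (by positivity)
    · have := Real.log_le_log (by exact_mod_cast h0) hb
      rwa [Real.log_mul (by positivity) (by positivity), Real.log_pow] at this
  have h2 : m * Real.log η ≤ Real.log η / Real.log N * (Real.log D + Real.log (1 / ε)) := by
    calc m * Real.log η = Real.log η / Real.log N * (m * Real.log N) := by field_simp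
      _ ≤ _ := by gcongr
  linarith

lemma le_lowerBoxDim_of_le_boxCount (hN : 2 ≤ N) (hD : 0 < D) (hη : 1 ≤ η) (hC : 0 < C) (m₀ : ℕ)
    (h : ∀ (m : ℕ) (ε : ℝ), m₀ ≤ m → 0 < ε → (N : ℝ) ^ m ≤ D / ε → D / ε < (N : ℝ) ^ (m + 1) →
      C * η ^ m ≤ (boxCount E ε : ℝ)) :
    ((Real.log η / Real.log N : ℝ) : EReal) ≤ lowerBoxDim E := by
  have hN1 : (1 : ℝ) < N := by exact_mod_cast hN
  have hlN : 0 < Real.log N := Real.log_pos hN1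
  have hlη : 0 ≤ Real.log η := Real.log_nonneg hη
  refine le_lowerBoxDim_of_le_log (K := Real.log η / Real.log N * Real.log D + Real.log C -
    Real.log η) ?_
  filter_upwards [Ioo_mem_nhdsGT (lt_min hD (by positivity : 0 < D / (N : ℝ) ^ m₀))] with ε hε
  have hε0 : 0 < ε := hε.1
  obtain ⟨m, hm1, hm2⟩ := exists_nat_pow_near
    ((one_le_div hε.1).2 (hε.2.le.trans (min_le_left _ _))) hN1
  have hm₀ : m₀ ≤ m := by
    have h3 : ε < D / (N : ℝ) ^ m₀ := hε.2.trans_le (min_le_right _ _)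
    have h4 : (N : ℝ) ^ m₀ < D / ε := by
      rw [lt_div_iff₀ hε0]; rwa [lt_div_iff₀' (by positivity)] at h3
    have := (pow_lt_pow_iff_right₀ hN1).1 (h4.trans hm2)
    omega
  have hmlog : Real.log D + Real.log (1 / ε) ≤ (m + 1) * Real.log N := by
    have := Real.log_le_log (by positivity) hm2.le
    rw [Real.log_pow, div_eq_mul_one_div, Real.log_mul hD.ne' (by positivity)] at this
    exact_mod_cast this
  have h1 : Real.log C + m * Real.log η ≤ Real.log (boxCount E ε) := by
    have := Real.log_le_log (by positivity) (h m ε hm₀ hε0 hm1 hm2)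
    rwa [Real.log_mul (by positivity) (by positivity), Real.log_pow] at this
  have h2 : Real.log η / Real.log N * (Real.log D + Real.log (1 / ε)) ≤ (m + 1) * Real.log η := by
    calc _ ≤ Real.log η / Real.log N * ((m + 1) * Real.log N) := by gcongr
      _ = _ := by field_simp
  linarith

variable {F : ℝ → ℝ} {x₀ θ : ℝ}

lemma log_mul_div_log (hN : 2 ≤ N) (hθ : 0 < θ) :
    Real.log (N * θ) / Real.log N = 1 + Real.log θ / Real.log N := by
  have hN1 : (1 : ℝ) < N := by exact_mod_cast hN
  rw [Real.log_mul (by positivity) hθ.ne', add_div, div_self (Real.log_pos hN1).ne']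

/-- Level `m₀ + m + 1` is finer than `ε` by a bounded factor, which only enlarges the constant. Both
terms of `boxCount_le` are then at most a multiple of `(N θ) ^ m`. -/
lemma upperBoxDim_scaledGraph_le (hF : ContinuousOn F (Set.Icc 0 1)) (hN : 2 ≤ N) (hD : 0 < D)
    (hθ : 1 ≤ θ) (hC : 0 ≤ C) {m₀ : ℕ} (h : ∀ p, oscSum F (N ^ (m₀ + p)) ≤ C * θ ^ p) :
    upperBoxDim (scaledGraph x₀ D F) ≤ ((1 + Real.log θ / Real.log N : ℝ) : EReal) := by
  have hN1 : (1 : ℝ) < N := by exact_mod_cast hN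
  have hNpos : 0 < N := by omega
  rw [← log_mul_div_log hN (by positivity)]
  refine upperBoxDim_le_of_boxCount_le (D := D)
    (C := (N : ℝ) ^ (m₀ + 1) * (6 * (C * θ / D) + 6)) hN hD
    (one_le_mul_of_one_le_of_one_le hN1.le hθ) fun m ε hε hm1 hm2 => ?_
  have h1 : D / (N ^ (m₀ + (m + 1)) : ℕ) ≤ ε := by
    push_cast
    rw [div_lt_iff₀ hε] at hm2
    rw [div_le_iff₀ (by positivity)]
    refine hm2.le.trans ?_
    rw [mul_comm ε]
    exact mul_le_mul_of_nonneg_right (pow_le_pow_right₀ hN1.le (by omega)) hε.le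
  have h2 := boxCount_le (x₀ := x₀) hF hD (pow_pos hNpos _) hε h1
  have h3 : 1 / ε ≤ (N : ℝ) ^ (m + 1) / D := by
    rw [le_div_iff₀ hD, one_div_mul_eq_div]; exact hm2.le
  have h4 : oscSum F (N ^ (m₀ + (m + 1))) / ε ≤ C * θ ^ (m + 1) * ((N : ℝ) ^ (m + 1) / D) := by
    rw [div_eq_mul_one_div]
    exact mul_le_mul (h _) h3 (by positivity) (by positivity)
  have hθm : (1 : ℝ) ≤ θ ^ m := one_le_pow₀ hθ
  have hNm : (1 : ℝ) ≤ (N : ℝ) ^ m₀ := one_le_pow₀ hN1.le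
  push_cast at h2
  have h5 : 6 * (C * θ ^ (m + 1) * ((N : ℝ) ^ (m + 1) / D)) ≤
      (N : ℝ) ^ (m₀ + 1) * (6 * (C * θ / D)) * (N * θ) ^ m := by
    have e : (N : ℝ) ^ (m₀ + 1) * (6 * (C * θ / D)) * (N * θ) ^ m =
      (N : ℝ) ^ m₀ * (6 * (C * θ ^ (m + 1) * ((N : ℝ) ^ (m + 1) / D))) := by
      rw [mul_pow]; ring
    rw [e]
    exact le_mul_of_one_le_left (by positivity) hNm
  have h6 : 6 * (N : ℝ) ^ (m₀ + (m + 1)) ≤ (N : ℝ) ^ (m₀ + 1) * 6 * (N * θ) ^ m := by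
    have e : (N : ℝ) ^ (m₀ + 1) * 6 * (N * θ) ^ m = 6 * (N : ℝ) ^ (m₀ + (m + 1)) * θ ^ m := by
      rw [mul_pow]; ring
    rw [e]
    exact le_mul_of_one_le_right (by positivity) hθm
  calc (boxCount (scaledGraph x₀ D F) ε : ℝ) ≤ _ := h2
    _ ≤ 6 * (C * θ ^ (m + 1) * ((N : ℝ) ^ (m + 1) / D)) + 6 * (N : ℝ) ^ (m₀ + (m + 1)) := by
        gcongr
    _ ≤ _ := add_le_add h5 h6
    _ = _ := by ring

lemma one_le_lowerBoxDim_scaledGraph (hF : ContinuousOn F (Set.Icc 0 1)) (hD : 0 < D) :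
    (1 : EReal) ≤ lowerBoxDim (scaledGraph x₀ D F) := by
  -- Any base would do: with base `2` and growth `2` the quotient of logarithms is `1`.
  have h := le_lowerBoxDim_of_le_boxCount (E := scaledGraph x₀ D F) (N := 2) (D := D) (η := 2)
    (C := 1 / 3) le_rfl hD (by norm_num) (by norm_num) 0 fun m ε _ hε hm1 _ => by
      have h1 := natCast_le_boxCount (x₀ := x₀) hF hD (M := 2 ^ m) (by positivity) hε (by
        rw [le_div_iff₀ hε] at hm1
        rw [le_div_iff₀ (by positivity), mul_comm]
        exact_mod_cast hm1)
      push_cast at h1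
      linarith
  rw [Nat.cast_ofNat, div_self (Real.log_pos (by norm_num)).ne'] at h
  exact_mod_cast h

lemma le_lowerBoxDim_scaledGraph (hF : ContinuousOn F (Set.Icc 0 1)) (hN : 2 ≤ N) (hD : 0 < D)
    (hθ : 1 ≤ θ) (hC : 0 < C) {m₀ : ℕ} (h : ∀ p, C * θ ^ p ≤ oscSum F (N ^ (m₀ + p))) :
    ((1 + Real.log θ / Real.log N : ℝ) : EReal) ≤ lowerBoxDim (scaledGraph x₀ D F) := by
  have hN1 : (1 : ℝ) < N := by exact_mod_cast hN
  have hNpos : 0 < N := by omega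
  have hθ0 : 0 < θ := by positivity
  rw [← log_mul_div_log hN hθ0]
  refine le_lowerBoxDim_of_le_boxCount (D := D) (C := C / (3 * D * θ ^ m₀)) hN hD
    (one_le_mul_of_one_le_of_one_le hN1.le hθ) (by positivity) m₀ fun m ε hm hε hm1 _ => ?_
  obtain ⟨p, rfl⟩ := Nat.exists_eq_add_of_le hm
  have h1 : ε ≤ D / (N ^ (m₀ + p) : ℕ) := by
    rw [le_div_iff₀ hε] at hm1
    rw [le_div_iff₀ (by positivity), mul_comm]
    exact_mod_cast hm1
  have h2 := oscSum_div_le_boxCount (x₀ := x₀) hF hD (pow_pos hNpos _) hε h1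
  have h3 : (N : ℝ) ^ (m₀ + p) / D ≤ 1 / ε := by
    rw [div_le_iff₀ hD, one_div_mul_eq_div]; exact hm1
  have h4 : C * θ ^ p * ((N : ℝ) ^ (m₀ + p) / D) ≤ oscSum F (N ^ (m₀ + p)) / ε := by
    rw [div_eq_mul_one_div (oscSum _ _)]
    exact mul_le_mul (h _) h3 (by positivity) (oscSum_nonneg _ _)
  have e : C / (3 * D * θ ^ m₀) * (N * θ) ^ (m₀ + p) =
      (C * θ ^ p * ((N : ℝ) ^ (m₀ + p) / D)) / 3 := by
    rw [mul_pow, pow_add θ]; field_simp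
  rw [e]
  linarith

end Dimension

/-! ### Transfer to the fractal interpolation function on `I`. -/

namespace AffineIFS

open Set

variable {N : ℕ} (W : AffineIFS N)

/-- The length of `I`. -/
def len : ℝ := W.x (Fin.last N) - W.x 0

/-- The affine parametrization of `I` by `[0, 1]`. -/
def param (t : ℝ) : ℝ := W.x 0 + W.len * t

lemma N_pos (W : AffineIFS N) : 0 < N := lt_of_lt_of_le two_pos W.two_le

lemma x_lt : W.x 0 < W.x (Fin.last N) := W.strictMono_x (by
  rw [Fin.lt_def]
  simpa using W.N_pos)

lemma len_pos : 0 < W.len := sub_pos.2 W.x_lt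

lemma param_strictMono : StrictMono W.param := fun a b hab => by
  have := mul_lt_mul_of_pos_left hab W.len_pos
  simp only [param]; linarith

lemma image_param : W.param '' Icc 0 1 = W.I := by
  have := image_affine_unit W.x_lt
  rw [I, ← this]
  exact congrArg (· '' Icc 0 1) (funext fun t => by rw [param, len, mul_comm])

lemma param_mem {t : ℝ} (ht : t ∈ Icc (0 : ℝ) 1) : W.param t ∈ W.I :=
  W.image_param ▸ mem_image_of_mem _ ht

lemma continuous_param : Continuous W.param := by unfold param; fun_prop

lemma graph_eq (f : ℝ → ℝ) : W.graph f = scaledGraph (W.x 0) W.len (f ∘ W.param) := by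
  rw [graph, ← image_param, image_image]
  rfl

lemma eVariationOn_comp_param (g : ℝ → ℝ) :
    eVariationOn (g ∘ W.param) (Icc 0 1) = eVariationOn g W.I := by
  rw [eVariationOn.comp_eq_of_monotoneOn g _ (W.param_strictMono.monotone.monotoneOn _),
    image_param]

lemma continuousOn_comp_param {g : ℝ → ℝ} (hg : ContinuousOn g W.I) :
    ContinuousOn (g ∘ W.param) (Icc 0 1) :=
  hg.comp W.continuous_param.continuousOn fun _ ht => W.param_mem ht

lemma x_eq (hA1 : W.A1) (m : ℕ) (hm : m < N + 1) : W.x ⟨m, hm⟩ = W.param ((m : ℝ) / N) := by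
  induction m with
  | zero => simp [param]
  | succ m ih =>
    have h1 := hA1 ⟨m, by omega⟩
    have h2 := ih (by omega)
    simp only [Fin.succ_mk, Fin.castSucc_mk] at h1
    rw [h2] at h1
    rw [sub_eq_iff_eq_add.1 h1]
    simp only [param, len]
    push_cast
    ring

/-- Equal spacing makes `param` conjugate `L_i` to `t ↦ (i + t) / N`. -/
lemma L_param (hA1 : W.A1) (i : Fin N) (t : ℝ) :
    W.L i (W.param t) = W.param (((i : ℝ) + t) / N) := by
  have h1 : W.x i.castSucc = W.param ((i : ℝ) / N) := W.x_eq hA1 i (by omega)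
  have h0 := W.len_pos.ne'
  have hN : (N : ℝ) ≠ 0 := by exact_mod_cast W.N_pos.ne'
  rw [L, hA1 i, h1]
  change W.len / N / W.len * (W.param t - W.x 0) + _ = _
  simp only [param]
  field_simp
  ring

/-- Invariance puts `W_i (u, f u)` on the graph, and a graph has one point over each abscissa. -/
lemma f_L {f : ℝ → ℝ} (hf : W.IsFIF f) (i : Fin N) {u : ℝ} (hu : u ∈ W.I) :
    f (W.L i u) = W.S i u * f u + W.q i u := by
  have h1 : W.map i (u, f u) ∈ W.graph f := by
    rw [hf.2]
    exact mem_iUnion.2 ⟨i, mem_image_of_mem _ (mem_image_of_mem _ hu)⟩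
  obtain ⟨v, -, hv⟩ := h1
  simp only [map, Prod.mk.injEq] at hv
  rw [← hv.1, hv.2]

/-- A fractal interpolation function as a self-affine function on `[0, 1]`. -/
noncomputable def selfAffine (hA1 : W.A1) (hA2 : W.A2) (hA3 : W.A3) {f : ℝ → ℝ} (hf : W.IsFIF f) :
    SelfAffine (f ∘ W.param) N where
  -- The value `0` for `i ≥ N` is a default; the conditions concern `i < N` only.
  S i := if h : i < N then W.S ⟨i, h⟩ ∘ W.param else 0
  q i := if h : i < N then W.q ⟨i, h⟩ ∘ W.param else 0
  pos := W.N_pos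
  continuousOn_F := W.continuousOn_comp_param hf.1
  continuousOn_S i hi := by
    rw [dif_pos hi]; exact W.continuousOn_comp_param (W.continuousOn_S _)
  bv_S i hi := by
    rw [dif_pos hi, BoundedVariationOn, eVariationOn_comp_param]
    obtain ⟨K, hK⟩ := (hA2 ⟨i, hi⟩).1
    have h1 := hK.locallyBoundedVariationOn _ _ (left_mem_Icc.2 W.x_lt.le)
      (right_mem_Icc.2 W.x_lt.le)
    exact h1.mono (subset_inter subset_rfl subset_rfl)
  bv_q i hi := by
    rw [dif_pos hi, BoundedVariationOn, eVariationOn_comp_param]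
    exact hA3 ⟨i, hi⟩
  map_eq i hi t ht := by
    rw [dif_pos hi, dif_pos hi]
    have := W.f_L hf ⟨i, hi⟩ (W.param_mem ht)
    rw [W.L_param hA1] at this
    exact this

lemma subI_eq (k : ℕ) (j : Fin (N ^ k)) : W.subI k j = W.param '' part (N ^ k) j := by
  have h0 := W.len_pos
  ext x
  simp only [subI, part, mem_image, mem_Icc, param, len] at h0 ⊢
  push_cast
  constructor
  · rintro ⟨h1, h2⟩
    refine ⟨(x - W.x 0) / (W.x (Fin.last N) - W.x 0), ⟨?_, ?_⟩, by field_simp; ring⟩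
    · rw [le_div_iff₀ h0]; linarith
    · rw [div_le_iff₀ h0]; linarith
  · rintro ⟨t, ⟨h1, h2⟩, rfl⟩
    have h3 := mul_le_mul_of_nonneg_left h1 h0.le
    have h4 := mul_le_mul_of_nonneg_left h2 h0.le
    constructor <;> linarith

lemma subI_subset (k : ℕ) (j : Fin (N ^ k)) : W.subI k j ⊆ W.I := by
  rw [subI_eq, ← image_param]
  exact image_mono (part_subset j.isLt)

lemma subI_nonempty (k : ℕ) (j : Fin (N ^ k)) : (W.subI k j).Nonempty := by
  rw [subI_eq]
  exact (nonempty_Icc.2 (by gcongr; linarith)).image _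

lemma subI_subset_parent (k : ℕ) (j : Fin (N ^ (k + 1))) :
    W.subI (k + 1) j ⊆ W.subI k (parentIdx j) := by
  rw [subI_eq, subI_eq]
  refine image_mono ?_
  have h := part_subset_part (M := N ^ k) (c := j.val / N) (pow_pos W.N_pos k)
    (Nat.mod_lt j.val W.N_pos)
  rwa [Nat.div_add_mod'] at h

lemma abs_S_le_sUp {k : ℕ} {i : Fin N} {j : Fin (N ^ k)} {t : ℝ} (ht : t ∈ W.subI k j) :
    |W.S i t| ≤ W.sUp k i j := by
  refine le_csSup ⟨1, ?_⟩ (mem_image_of_mem _ ht)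
  rintro _ ⟨u, hu, rfl⟩
  exact (W.abs_S_lt_one i u (W.subI_subset k j hu)).le

lemma sLow_le_abs_S {k : ℕ} {i : Fin N} {j : Fin (N ^ k)} {t : ℝ} (ht : t ∈ W.subI k j) :
    W.sLow k i j ≤ |W.S i t| := by
  refine csInf_le ⟨0, ?_⟩ (mem_image_of_mem _ ht)
  rintro _ ⟨u, hu, rfl⟩
  exact abs_nonneg _

lemma sUp_nonneg (k : ℕ) (i : Fin N) (j : Fin (N ^ k)) : 0 ≤ W.sUp k i j :=
  Real.sSup_nonneg (by rintro _ ⟨u, hu, rfl⟩; exact abs_nonneg _)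

lemma sLow_nonneg (k : ℕ) (i : Fin N) (j : Fin (N ^ k)) : 0 ≤ W.sLow k i j :=
  Real.sInf_nonneg (by rintro _ ⟨u, hu, rfl⟩; exact abs_nonneg _)

lemma sLow_le_sUp (k : ℕ) (i : Fin N) (j : Fin (N ^ k)) : W.sLow k i j ≤ W.sUp k i j := by
  obtain ⟨t, ht⟩ := W.subI_nonempty k j
  exact (W.sLow_le_abs_S ht).trans (W.abs_S_le_sUp ht)

lemma sUp_succ_le (k : ℕ) (i : Fin N) (j : Fin (N ^ (k + 1))) :
    W.sUp (k + 1) i j ≤ W.sUp k i (parentIdx j) := by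
  refine csSup_le ((W.subI_nonempty _ _).image _) ?_
  rintro _ ⟨u, hu, rfl⟩
  exact W.abs_S_le_sUp (W.subI_subset_parent k j hu)

lemma sLow_le_succ (k : ℕ) (i : Fin N) (j : Fin (N ^ (k + 1))) :
    W.sLow k i (parentIdx j) ≤ W.sLow (k + 1) i j := by
  refine le_csInf ((W.subI_nonempty _ _).image _) ?_
  rintro _ ⟨u, hu, rfl⟩
  exact W.sLow_le_abs_S (W.subI_subset_parent k j hu)

lemma antitone_radius_MUp : Antitone fun k => matrixSpectralRadius (W.MUp k) :=
  antitone_nat_of_succ_le fun _ => matrixSpectralRadius_scalingMatrix_antitone W.N_pos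
    (W.sUp_nonneg _) (W.sUp_nonneg _) (W.sUp_succ_le _)

lemma monotone_radius_MLow : Monotone fun k => matrixSpectralRadius (W.MLow k) :=
  monotone_nat_of_le_succ fun _ => matrixSpectralRadius_scalingMatrix_monotone W.N_pos
    (W.sLow_nonneg _) (W.sLow_nonneg _) (W.sLow_le_succ _)

lemma radius_MLow_le_MUp (k : ℕ) :
    matrixSpectralRadius (W.MLow k) ≤ matrixSpectralRadius (W.MUp k) :=
  matrixSpectralRadius_mono (scalingMatrix_nonneg (W.sLow_nonneg _))
    (scalingMatrix_mono (W.sLow_le_sUp _))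

lemma exists_tendsto_radius_MUp :
    ∃ ρ, Tendsto (fun k => matrixSpectralRadius (W.MUp k)) atTop (𝓝 ρ) :=
  ⟨_, tendsto_atTop_ciInf W.antitone_radius_MUp
    ⟨0, by rintro _ ⟨k, rfl⟩; exact matrixSpectralRadius_nonneg _⟩⟩

lemma exists_tendsto_radius_MLow :
    ∃ ρ, Tendsto (fun k => matrixSpectralRadius (W.MLow k)) atTop (𝓝 ρ) :=
  ⟨_, tendsto_atTop_ciSup W.monotone_radius_MLow
    ⟨matrixSpectralRadius (W.MUp 0), by
      rintro _ ⟨k, rfl⟩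
      exact (W.radius_MLow_le_MUp k).trans (W.antitone_radius_MUp (Nat.zero_le k))⟩⟩

/-- Compactness of `I` upgrades `|S_i| < 1` to a uniform contraction factor. -/
lemma exists_abs_S_le : ∃ s < 1, ∀ i, ∀ t ∈ W.I, |W.S i t| ≤ s := by
  have h1 : ∀ i, ∃ s < 1, ∀ t ∈ W.I, |W.S i t| ≤ s := fun i => by
    obtain ⟨t, ht, hmax⟩ := isCompact_Icc.exists_isMaxOn (nonempty_Icc.2 W.x_lt.le)
      (W.continuousOn_S i).abs
    exact ⟨|W.S i t|, W.abs_S_lt_one i t ht, fun u hu => hmax hu⟩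
  choose s hs1 hs using h1
  have hne : (Finset.univ : Finset (Fin N)).Nonempty := ⟨⟨0, W.N_pos⟩, Finset.mem_univ _⟩
  refine ⟨Finset.univ.sup' hne s, (Finset.sup'_lt_iff hne).2 fun i _ => hs1 i, fun i t ht => ?_⟩
  exact (hs i t ht).trans (Finset.le_sup' s (Finset.mem_univ i))

section Dimension

variable {W}

lemma selfAffine_S (hA1 : W.A1) (hA2 : W.A2) (hA3 : W.A3) {f : ℝ → ℝ}
    (hf : W.IsFIF f) {i : ℕ} (hi : i < N) (t : ℝ) :
    (W.selfAffine hA1 hA2 hA3 hf).S i t = W.S ⟨i, hi⟩ (W.param t) := by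
  simp [selfAffine, hi]

lemma upperBoxDim_graph_le_of_lt (hA1 : W.A1) (hA2 : W.A2) (hA3 : W.A3) {f : ℝ → ℝ}
    (hf : W.IsFIF f) {θ : ℝ} (hθ1 : 1 < θ) (k : ℕ)
    (hθ : matrixSpectralRadius (W.MUp k) < θ) :
    upperBoxDim (W.graph f) ≤ ((1 + Real.log θ / Real.log N : ℝ) : EReal) := by
  obtain ⟨c, hc⟩ := oscVec_succ_le (W.selfAffine hA1 hA2 hA3 hf) k (s := W.sUp (k + 1))
    fun i j t ht => by
      rw [selfAffine_S hA1 hA2 hA3 hf i.isLt]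
      exact W.abs_S_le_sUp (W.subI_eq _ j ▸ mem_image_of_mem _ ht)
  obtain ⟨C, hC0, hC⟩ := sum_le_of_affine_recursion (scalingMatrix_nonneg (W.sUp_nonneg _)) hc
    hθ1 hθ
  rw [graph_eq]
  refine upperBoxDim_scaledGraph_le (W.continuousOn_comp_param hf.1) W.two_le W.len_pos hθ1.le hC0
    (m₀ := k + 1) fun p => ?_
  rw [← sum_oscVec]
  exact hC p

lemma le_lowerBoxDim_graph_of_lt (hA1 : W.A1) (hA2 : W.A2) (hA3 : W.A3) {f : ℝ → ℝ}
    (hf : W.IsFIF f) (hz : ∀ i, {t ∈ W.I | W.S i t = 0}.Finite)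
    (hvar : eVariationOn f W.I = ⊤) {θ : ℝ} (hθ1 : 1 < θ) (k : ℕ)
    (hθ : θ < matrixSpectralRadius (W.MLow k)) :
    ((1 + Real.log θ / Real.log N : ℝ) : EReal) ≤ lowerBoxDim (W.graph f) := by
  let A := W.selfAffine hA1 hA2 hA3 hf
  have hF := W.continuousOn_comp_param hf.1
  obtain ⟨c, hc0, hc⟩ := le_oscVec_succ A k (s := W.sLow (k + 1))
    fun i j t ht => by
      rw [selfAffine_S hA1 hA2 hA3 hf i.isLt]
      exact W.sLow_le_abs_S (W.subI_eq _ j ▸ mem_image_of_mem _ ht)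
  obtain ⟨s, hs1, hs⟩ := W.exists_abs_S_le
  have hcell : ∀ r : Fin (N ^ (k + 1)),
      eVariationOn (f ∘ W.param) (part (N ^ (k + 1)) r) = ⊤ := fun r => by
    have := A.eVariationOn_cell_eq_top W.two_le hs1 (fun i hi t ht => by
        rw [selfAffine_S hA1 hA2 hA3 hf hi]; exact hs _ _ (W.param_mem ht))
      (fun i hi => by
        refine ((hz ⟨i, hi⟩).preimage W.param_strictMono.injective.injOn).subset ?_
        rintro t ⟨ht, h0⟩
        rw [selfAffine_S hA1 hA2 hA3 hf hi] at h0
        exact ⟨W.param_mem ht, h0⟩)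
      (by rw [eVariationOn_comp_param, hvar]) (k + 1) r.isLt
    simpa [part] using this
  obtain ⟨C, hC0, p₀, hC⟩ := le_sum_of_affine_recursion
    (scalingMatrix_nonneg (W.sLow_nonneg _)) (oscVec_nonneg _ N (k + 1)) hc0 hc
    (fun T => (eventually_all.2 fun r =>
      (tendsto_oscVec hF W.two_le r (hcell r)).eventually_ge_atTop T).exists) hθ1 hθ
  rw [graph_eq]
  refine le_lowerBoxDim_scaledGraph hF W.two_le W.len_pos hθ1.le hC0 (m₀ := k + 1 + p₀) fun p => ?_
  rw [add_assoc, ← sum_oscVec]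
  exact hC p

/-- The affine term forces `θ > 1`, hence `max 1 ρ`. Each such `θ > ρ` exceeds the radius at some
level, and `θ` decreases to the maximum. -/
lemma upperBoxDim_graph_le (hA1 : W.A1) (hA2 : W.A2) (hA3 : W.A3) {f : ℝ → ℝ}
    (hf : W.IsFIF f) {ρ : ℝ}
    (hρ : Tendsto (fun k => matrixSpectralRadius (W.MUp k)) atTop (𝓝 ρ)) :
    upperBoxDim (W.graph f) ≤ ((1 + Real.log (max 1 ρ) / Real.log N : ℝ) : EReal) := by
  have hcont : Tendsto (fun θ : ℝ => ((1 + Real.log θ / Real.log N : ℝ) : EReal))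
      (𝓝[>] (max 1 ρ)) (𝓝 ((1 + Real.log (max 1 ρ) / Real.log N : ℝ) : EReal)) := by
    have h1 : Tendsto Real.log (𝓝[>] (max 1 ρ)) (𝓝 (Real.log (max 1 ρ))) :=
      (Real.continuousAt_log (by positivity)).tendsto.mono_left nhdsWithin_le_nhds
    exact (continuous_coe_real_ereal.tendsto _).comp ((h1.div_const _).const_add 1)
  refine ge_of_tendsto hcont ?_
  filter_upwards [self_mem_nhdsWithin] with θ hθ
  obtain ⟨h1, h2⟩ := max_lt_iff.1 (mem_Ioi.1 hθ)
  obtain ⟨k, hk⟩ := (hρ.eventually (gt_mem_nhds h2)).exists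
  exact upperBoxDim_graph_le_of_lt hA1 hA2 hA3 hf h1 k hk

lemma one_le_lowerBoxDim_graph {f : ℝ → ℝ} (hf : W.IsFIF f) : (1 : EReal) ≤ lowerBoxDim (W.graph f) := by
  rw [graph_eq]
  exact one_le_lowerBoxDim_scaledGraph (W.continuousOn_comp_param hf.1) W.len_pos

lemma upperBoxDim_graph_le_one_of_bv {f : ℝ → ℝ} (hf : W.IsFIF f) (hvar : eVariationOn f W.I ≠ ⊤) :
    upperBoxDim (W.graph f) ≤ 1 := by
  rw [← eVariationOn_comp_param] at hvar
  have := upperBoxDim_scaledGraph_le (x₀ := W.x 0) (W.continuousOn_comp_param hf.1) W.two_le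
    W.len_pos le_rfl ENNReal.toReal_nonneg (m₀ := 0) fun p => by
      rw [one_pow, mul_one]
      exact oscSum_le_variation hvar (pow_pos W.N_pos _)
  rw [graph_eq]
  simpa using this

lemma le_lowerBoxDim_graph (hA1 : W.A1) (hA2 : W.A2) (hA3 : W.A3) {f : ℝ → ℝ}
    (hf : W.IsFIF f) (hz : ∀ i, {t ∈ W.I | W.S i t = 0}.Finite)
    (hvar : eVariationOn f W.I = ⊤) {ρ : ℝ} (hρ1 : 1 < ρ)
    (hρ : Tendsto (fun k => matrixSpectralRadius (W.MLow k)) atTop (𝓝 ρ)) :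
    ((1 + Real.log ρ / Real.log N : ℝ) : EReal) ≤ lowerBoxDim (W.graph f) := by
  have hcont : Tendsto (fun θ : ℝ => ((1 + Real.log θ / Real.log N : ℝ) : EReal))
      (𝓝[<] ρ) (𝓝 ((1 + Real.log ρ / Real.log N : ℝ) : EReal)) := by
    have h1 : Tendsto Real.log (𝓝[<] ρ) (𝓝 (Real.log ρ)) :=
      (Real.continuousAt_log (by positivity)).tendsto.mono_left nhdsWithin_le_nhds
    exact (continuous_coe_real_ereal.tendsto _).comp ((h1.div_const _).const_add 1)
  refine le_of_tendsto hcont ?_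
  filter_upwards [Ioo_mem_nhdsLT hρ1] with θ hθ
  obtain ⟨k, hk⟩ := (hρ.eventually (lt_mem_nhds hθ.2)).exists
  exact le_lowerBoxDim_graph_of_lt hA1 hA2 hA3 hf hz hvar hθ.1 k hk

end Dimension

end AffineIFS

theorem mainTheorem1 (N : ℕ) (W : AffineIFS N) (hA1 : W.A1) (hA2 : W.A2) (hA3 : W.A3)
    (f : ℝ → ℝ) (hf : W.IsFIF f) :
    ∃ rhoUp rhoLow : ℝ,
      Tendsto (fun k => matrixSpectralRadius (W.MUp k)) atTop (𝓝 rhoUp) ∧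
      Tendsto (fun k => matrixSpectralRadius (W.MLow k)) atTop (𝓝 rhoLow) ∧
      ((∀ i, ∀ a b : ℝ, a < b → Set.Icc a b ⊆ W.I → ∃ t ∈ Set.Icc a b, W.S i t ≠ 0) →
        upperBoxDim (W.graph f) ≤
          ((max 1 (1 + Real.log rhoUp / Real.log N) : ℝ) : EReal)) ∧
      (1 ≤ W.gammaLow → (∀ i, {t ∈ W.I | W.S i t = 0}.Finite) → eVariationOn f W.I = ⊤ →
        ((1 + Real.log rhoLow / Real.log N : ℝ) : EReal) ≤ lowerBoxDim (W.graph f)) ∧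
      (rhoLow = rhoUp → (∀ i, {t ∈ W.I | W.S i t = 0}.Finite) →
        (eVariationOn f W.I = ⊤ ∧ 1 < rhoUp →
          HasBoxDim (W.graph f) (1 + Real.log rhoUp / Real.log N)) ∧
        (¬ (eVariationOn f W.I = ⊤ ∧ 1 < rhoUp) → HasBoxDim (W.graph f) 1)) := by
  obtain ⟨rhoUp, hUp⟩ := W.exists_tendsto_radius_MUp
  obtain ⟨rhoLow, hLow⟩ := W.exists_tendsto_radius_MLow
  have hLow0 : 0 ≤ rhoLow := ge_of_tendsto' hLow fun k => matrixSpectralRadius_nonneg _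
  have hlogN : 0 < Real.log N := Real.log_pos (by exact_mod_cast W.two_le)
  have hupper := AffineIFS.upperBoxDim_graph_le hA1 hA2 hA3 hf hUp
  have hone := AffineIFS.one_le_lowerBoxDim_graph hf
  have hle := lowerBoxDim_le_upperBoxDim (W.graph f)
  refine ⟨rhoUp, rhoLow, hUp, hLow, fun _ => hupper.trans ?_, fun _ hz hvar => ?_,
    fun heq hz => ⟨fun ⟨hvar, hρ⟩ => ?_, fun hnot => ?_⟩⟩
  · rw [EReal.coe_le_coe_iff]
    -- This includes `rhoUp = 0`: there `Real.log 0 = 0`, so the stated bound equals `1`.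
    rcases le_total rhoUp 1 with h | h
    · rw [max_eq_left h, Real.log_one, zero_div, add_zero]
      exact le_max_left _ _
    · rw [max_eq_right h]
      exact le_max_right _ _
  -- For `rhoLow ≤ 1` the logarithm is nonpositive (`0` at `0`), so the universal lower bound `1`
  -- suffices.
  · rcases le_or_gt rhoLow 1 with h | h
    · refine le_trans ?_ hone
      rw [← EReal.coe_one, EReal.coe_le_coe_iff]
      linarith [div_nonpos_of_nonpos_of_nonneg (Real.log_nonpos hLow0 h) hlogN.le]
    · exact AffineIFS.le_lowerBoxDim_graph hA1 hA2 hA3 hf hz hvar h hLow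
  · have h1 := AffineIFS.le_lowerBoxDim_graph hA1 hA2 hA3 hf hz hvar (heq ▸ hρ) hLow
    rw [heq] at h1
    rw [max_eq_right hρ.le] at hupper
    exact ⟨le_antisymm (hle.trans hupper) h1, le_antisymm hupper (h1.trans hle)⟩
  -- Either the variation is finite and the oscillation sums are bounded, or `rhoUp ≤ 1` and the
  -- general upper bound is `1`.
  · have h1 : upperBoxDim (W.graph f) ≤ 1 := by
      by_cases hvar : eVariationOn f W.I = ⊤
      · have hρ : rhoUp ≤ 1 := not_lt.1 fun h => hnot ⟨hvar, h⟩
        simpa [max_eq_left hρ] using hupper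
      · exact AffineIFS.upperBoxDim_graph_le_one_of_bv hf hvar
    exact ⟨by exact_mod_cast le_antisymm (hle.trans h1) hone,
      by exact_mod_cast le_antisymm h1 (hone.trans hle)⟩
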